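/- **Setting.** Let $N\ge 1$. Let $\mathbb F_N^+$ be the free unital semigroup on $1,\dots,N$ (words, with empty word $\emptyset$), ordered by $\prec$: shorter words come first, and words of equal length are ordered lexicographically. Let $\emptyset=\sigma_0\prec\sigma_1\prec\sigma_2\prec\cdots$ be its elements, and write $X_\sigma=X_{i_1}\cdots X_{i_k}$ for $\sigma=i_1\dots i_k$. Let $\mathcal P_N\subset\mathcal P_{2N}$ be the complex algebras of polynomials in the non-commuting variables $X_1,\dots,X_N$, respectively $X_1,\dots,X_{2N}$. Let $\mathcal J$ be the conjugate-linear anti-multiplicative involution of $\mathcal P_{2N}$ with $\mathcal J(X_k)=X_{N+k}$ and $\mathcal J(X_{N+k})=X_k$ for $1\le k\le N$. Let $$\mathcal A_S=\{1-\mathcal J(X_k)X_k\mid 1\le k\le N\}\cup\{\mathcal J(X_k)X_l\mid 1\le k,l\le N,\ k\ne l\},$$ and let $\pi:\mathcal P_{2N}\to\mathcal T_N(\mathcal A_S)$ be the quotient map onto the quotient by the two-sided ideal generated by $\mathcal A_S$. Let $\phi$ be a linear functional on $\mathcal T_N(\mathcal A_S)$ that is unital, $\phi(1)=1$, and strictly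 positive: $\phi(\pi(\mathcal J(P)P))>0$ for all $P\in\mathcal P_N$ with $\pi(P)\neq 0$. Put $\langle P,Q\rangle_\phi=\phi(\pi(\mathcal J(Q)P))$ for $P,Q\in\mathcal P_N$, and $$K_\phi(m,n)=\phi(\pi(\mathcal J(X_{\sigma_m})X_{\sigma_n})),\qquad m,n\ge 0 .$$ **Orthogonal polynomials.** Let $\varphi_n=\varphi_{\sigma_n}\in\mathcal P_N$, $n\ge0$, be the polynomials obtained from $X_{\sigma_0},X_{\sigma_1},\dots$ by the Gram–Schmidt procedure for $\langle\cdot,\cdot\rangle_\phi$ (orthonormal, with positive leading coefficients). **Parameters.** Let $\gamma_{k,j}$, $0\le k<j$, be the parameters of $K_\phi$: the unique complex numbers of modulus less than $1$ such that $$K_\phi(k,j)=K_\phi(k,k)^{1/2}\,[\,1\ 0\ \cdots\ 0\,]\;U_{k,j}\;[\,1\ 0\ \cdots\ 0\,]^t\,K_\phi(j,j)^{1/2},\qquad k\le j,$$ where $U_{k,k}=1$ and $U_{k,j}=R_{k,k+1}R_{k,k+2}\cdots R_{k,j}\,(U_{k+1,j}\oplus 1)$ for $k<j$. Here $R_{k,k+l}$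 is the $(j-k+1)\times(j-k+1)$ matrix that acts as $$\begin{bmatrix}\gamma_{k,k+l}&d_{k,k+l}\\ d_{k,k+l}&-\overline{\gamma}_{k,k+l}\end{bmatrix},\qquad d_{k,j}=(1-|\gamma_{k,j}|^2)^{1/2},$$ on the $l$-th and $(l+1)$-st coordinates and as the identity on the others. **The polynomials $\varphi_n^\sharp$.** Put $\varphi_0^\sharp=1$ and, for $n\ge1$ with $\sigma_n=k\sigma$ ($1\le k\le N$, $\sigma\in\mathbb F_N^+$), $$\varphi_n^\sharp=\frac1{d_{0,n}}\left(-\overline{\gamma}_{0,n}X_k\varphi_\sigma+\varphi_{n-1}^\sharp\right).$$ **Spectral factor and Szegő class.** Given Hilbert spaces $\mathcal F_n$, $n\ge0$, consider lower triangular arrays $\Theta=[\Theta_{k,j}]_{k,j\ge0}$ of operators $\Theta_{k,j}:\mathbb C\to\mathcal F_k$ ($\Theta_{k,j}=0$ for $k<j$) whose columns $c_j(\Theta)=[\Theta_{k,j}]_{k\ge 0}$ belong to $\bigoplus_{k}\mathcal F_k$. Such an array is *outer* if for every $k\ge 0$ the set $\{c_j(\Theta)\mathbb C\mid j\ge k\}$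 is total in $\bigoplus_{j\ge k}\mathcal F_j$, and $K_\Theta(k,j)=c_k(\Theta)^*c_j(\Theta)$. For kernels, $K_1\le K_2$ means that $K_2-K_1$ is positive semidefinite. The *spectral factor* $\Theta_\phi$ is the unique outer array, with each $\mathcal F_n\in\{\{0\},\mathbb C\}$ and $(\Theta_\phi)_{n,n}\ge 0$ for all $n$, such that $K_{\Theta_\phi}\le K_\phi$ and $K_{\Theta'}\le K_{\Theta_\phi}$ for every outer array $\Theta'$ (with any Hilbert spaces) such that $K_{\Theta'}\le K_\phi$. The functional $\phi$ belongs to the *Szegő class* if $(\Theta_\phi)_{n,n}>0$ for all $n\ge 0$. **Theorem.** Let $\phi$ be as above and belong to the Szegő class. 1. $\varphi_n\to 0$ as $n\to\infty$, coefficient-wise: for every word $w$ the coefficient of $X_w$ in $\varphi_n$ tends to $0$. 2. The array $\Theta_\phi$ is given by a formal power series $\sum_w\theta_wX_w$ in the non-commuting variables $X_1,\dots,X_N$: for all $m,n\ge 0$, $(\Theta_\phi)_{m,n}=\theta_\alpha$ if $\sigma_m=\sigma_n\alpha$ for some word $\alpha$, and $(\Theta_\phi)_{m,n}=0$ otherwise.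 Every $\varphi_n^\sharp$ is invertible in the algebra of formal power series in $X_1,\dots,X_N$, and $$(\varphi_n^\sharp)^{-1}\to\Theta_\phi=\sum_w\theta_wX_w\qquad(n\to\infty)$$ coefficient-wise. -/

import Mathlib

open Filter Topology
open scoped ComplexOrder

namespace TreeSzego

noncomputable section

/-! ### Words and their enumeration -/

/-- The free unital semigroup on `N` generators. -/
abbrev Word (N : ℕ) := FreeMonoid (Fin N)

/-- The `n`-th word in the order in which shorter words come first and words of the same length
are ordered lexicographically; `wordAt 0` is the empty word.
(The letters are the digits of `n` in bijective base `N`.) -/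
def wordAt (N : ℕ) [NeZero N] : ℕ → Word N
  | 0 => 1
  | n + 1 => wordAt N (n / N) * FreeMonoid.of (Fin.ofNat N n)
termination_by n => n
decreasing_by exact Nat.lt_succ_of_le (Nat.div_le_self n N)

/-- The position of a word in this order. -/
def wordIndex {N : ℕ} (w : Word N) : ℕ :=
  w.toList.foldl (fun a i => N * a + (i : ℕ) + 1) 0

theorem wordIndex_mul_of {N : ℕ} (w : Word N) (i : Fin N) :
    wordIndex (w * FreeMonoid.of i) = N * wordIndex w + (i : ℕ) + 1 := by
  simp [wordIndex, FreeMonoid.toList_mul]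

theorem wordIndex_wordAt {N : ℕ} [NeZero N] (n : ℕ) : wordIndex (wordAt N n) = n := by
  induction n using Nat.strong_induction_on with
  | _ n ih =>
    cases n with
    | zero => simp [wordAt, wordIndex]
    | succ n =>
      rw [wordAt, wordIndex_mul_of, ih _ (Nat.lt_succ_of_le (Nat.div_le_self n N))]
      simp [Nat.div_add_mod]

theorem wordAt_wordIndex {N : ℕ} [NeZero N] (w : Word N) : wordAt N (wordIndex w) = w := by
  have hN : 0 < N := NeZero.pos N
  obtain ⟨l, rfl⟩ := FreeMonoid.ofList.surjective w
  induction l using List.reverseRecOn with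
  | nil => simp [wordIndex, wordAt]
  | append_singleton l i ih =>
    rw [FreeMonoid.ofList_append, FreeMonoid.ofList_singleton, wordIndex_mul_of, wordAt]
    have h1 : (N * wordIndex (FreeMonoid.ofList l) + (i : ℕ)) / N
        = wordIndex (FreeMonoid.ofList l) := by
      rw [Nat.mul_add_div hN, Nat.div_eq_of_lt i.2, add_zero]
    rw [h1, ih]
    congr 2
    ext
    simp [Nat.mod_eq_of_lt i.2]

/-- The enumeration is increasing for the order described above. -/
theorem shortlex_wordAt {N : ℕ} [NeZero N] {m n : ℕ} (h : m < n) :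
    List.Shortlex (· < ·) (wordAt N m).toList (wordAt N n).toList := by
  induction n using Nat.strong_induction_on generalizing m with
  | _ n ih =>
    obtain ⟨n, rfl⟩ : ∃ k, n = k + 1 := ⟨n - 1, by omega⟩
    cases m with
    | zero =>
      apply List.Shortlex.of_length_lt
      rw [wordAt, wordAt]
      simp
    | succ m =>
      have hN : 0 < N := NeZero.pos N
      have hle : m / N ≤ n / N := Nat.div_le_div_right (by omega)
      rw [wordAt, wordAt, FreeMonoid.toList_mul, FreeMonoid.toList_mul, List.shortlex_def]
      rcases hle.lt_or_eq with hlt | heq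
      · have := ih (n / N) (Nat.lt_succ_of_le (Nat.div_le_self n N)) hlt
        rcases List.shortlex_def.1 this with h1 | ⟨h1, h2⟩
        · left
          simpa using h1
        · right
          refine ⟨by simp [h1], ?_⟩
          clear this
          generalize (wordAt N (m / N)).toList = a at h1 h2
          generalize (wordAt N (n / N)).toList = b at h1 h2
          induction h2 with
          | nil => simp at h1
          | cons _ ih2 => exact List.Lex.cons (ih2 (by simpa using h1))
          | rel hr => exact List.Lex.rel hr
      · right
        rw [heq]
        refine ⟨by simp, ?_⟩
        apply List.Lex.append_left
        apply List.Lex.rel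
        have e1 := Nat.div_add_mod m N
        have e2 := Nat.div_add_mod n N
        rw [heq] at e1
        rw [Fin.lt_def]
        simp only [Fin.ofNat]
        omega

/-! ### Polynomials in non-commuting variables, the involution, the quotient algebra -/

/-- Polynomials in the non-commuting variables `X_1, …, X_N`. -/
abbrev PolyN (N : ℕ) := MonoidAlgebra ℂ (Word N)

/-- Polynomials in the `2N` non-commuting variables `X_1, …, X_N` (letters `Sum.inl k`) and
`X_{N+1}, …, X_{2N}` (letters `Sum.inr k`). -/
abbrev Poly2N (N : ℕ) := MonoidAlgebra ℂ (FreeMonoid (Fin N ⊕ Fin N))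

/-- The involution on monomials: reverse the word and exchange `X_k` and `X_{N+k}`. -/
def invWord {N : ℕ} (w : FreeMonoid (Fin N ⊕ Fin N)) : FreeMonoid (Fin N ⊕ Fin N) :=
  FreeMonoid.ofList (w.toList.map Sum.swap).reverse

/-- The involution `𝒥`, extended conjugate-linearly. -/
def invol {N : ℕ} (Q : Poly2N N) : Poly2N N :=
  Q.coeff.sum fun w c => MonoidAlgebra.single (invWord w) (star c)

/-- The inclusion of the polynomials in `X_1, …, X_N`. -/
def incl {N : ℕ} : PolyN N →ₐ[ℂ] Poly2N N :=
  MonoidAlgebra.mapDomainAlgHom ℂ ℂ (FreeMonoid.map Sum.inl)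

/-- The monomial `X_σ`. -/
def mono {N : ℕ} (σ : Word N) : PolyN N := MonoidAlgebra.single σ 1

/-- The variable `X_k`. -/
def var {N : ℕ} (k : Fin N) : PolyN N := mono (FreeMonoid.of k)

/-- The quotient of the algebra of polynomials in `2N` variables by the two-sided ideal
generated by `A`. -/
abbrev QuotAlg {N : ℕ} (A : Set (Poly2N N)) := RingQuot (fun P Q : Poly2N N => P ∈ A ∧ Q = 0)

/-- The quotient map. -/
def proj {N : ℕ} (A : Set (Poly2N N)) : Poly2N N →ₐ[ℂ] QuotAlg A :=
  RingQuot.mkAlgHom ℂ (fun P Q : Poly2N N => P ∈ A ∧ Q = 0)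

/-- The relations `𝒜_S` of stationary processes on the Cayley tree:
`1 - 𝒥(X_k) X_k` for all `k`, and `𝒥(X_k) X_l` for all `k ≠ l`. -/
def stationaryRel (N : ℕ) : Set (Poly2N N) :=
  {P | ∃ k : Fin N, P = 1 - invol (incl (var k)) * incl (var k)} ∪
    {P | ∃ k l : Fin N, k ≠ l ∧ P = invol (incl (var k)) * incl (var l)}

/-- `⟨P, Q⟩_φ = φ(𝒥(Q) P)` for polynomials `P`, `Q` in `X_1, …, X_N`. -/
def form {N : ℕ} {A : Set (Poly2N N)} (φ : QuotAlg A →ₗ[ℂ] ℂ) (P Q : PolyN N) : ℂ :=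
  φ (proj A (invol (incl Q) * incl P))

/-- `φ` is strictly positive: `φ(𝒥(P) P) > 0` for every polynomial `P` in `X_1, …, X_N` that is
not in the ideal generated by the relations. -/
def StrictlyPositive {N : ℕ} {A : Set (Poly2N N)} (φ : QuotAlg A →ₗ[ℂ] ℂ) : Prop :=
  ∀ P : PolyN N, proj A (incl P) ≠ 0 → 0 < form φ P P

/-- The kernel `K_φ(σ, τ) = φ(𝒥(X_σ) X_τ)`, the words being numbered by `wordAt`. -/
def kernel {N : ℕ} [NeZero N] {A : Set (Poly2N N)} (φ : QuotAlg A →ₗ[ℂ] ℂ) : Matrix ℕ ℕ ℂ :=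
  fun m n => form φ (mono (wordAt N n)) (mono (wordAt N m))

/-! ### The parameters of a positive definite kernel -/

/-- `d = (1 - |γ|²)^{1/2}`. -/
def defect (γ : ℂ) : ℂ := (Real.sqrt (1 - ‖γ‖ ^ 2) : ℝ)

/-- The action of the elementary rotation `[γ, d; d, -conj γ]` on the coordinates `i`, `i + 1`. -/
def rot (γ : ℂ) (i : ℕ) (v : ℕ → ℂ) : ℕ → ℂ := fun m =>
  if m = i then γ * v i + defect γ * v (i + 1)
  else if m = i + 1 then defect γ * v i - star γ * v (i + 1)
  else v m

/-- `rotProd g k n` is the product of the rotations with parameters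
`g k (k+1), g k (k+2), …, g k (k+n)`, the `l`-th of which acts on the coordinates `l - 1`, `l`
(so that the last one is applied first). -/
def rotProd (g : ℕ → ℕ → ℂ) (k : ℕ) : ℕ → (ℕ → ℂ) → (ℕ → ℂ)
  | 0, v => v
  | n + 1, v => rotProd g k n (rot (g k (k + n + 1)) n v)

/-- The unitary operator `U_{k,k+n}` determined by the parameters:
`U_{k,k} = 1` and `U_{k,j} = R(g k (k+1)) ⋯ R(g k j) (U_{k+1,j} ⊕ 1)`. -/
def latticeU (g : ℕ → ℕ → ℂ) : ℕ → ℕ → (ℕ → ℂ) → (ℕ → ℂ)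
  | _, 0, v => v
  | k, n + 1, v => rotProd g k (n + 1) (latticeU g (k + 1) n v)

/-- `g` is the family of parameters `γ_{k,j}`, `k < j`, of the kernel `K`: numbers of modulus less
than one such that `K k j = K(k,k)^{1/2} [1 0 …] U_{k,j} [1 0 …]ᵗ K(j,j)^{1/2}`. The irrelevant
entries with `j ≤ k` are set to `0`. -/
def IsParamFamily (K : Matrix ℕ ℕ ℂ) (g : ℕ → ℕ → ℂ) : Prop :=
  (∀ k j, j ≤ k → g k j = 0) ∧ (∀ k j, k < j → ‖g k j‖ < 1) ∧
    ∀ k n, K k (k + n) = (Real.sqrt (K k k).re : ℝ) * latticeU g k n (Pi.single 0 1) 0 *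
      (Real.sqrt (K (k + n) (k + n)).re : ℝ)

/-- The family of parameters `γ_{k,j}` of `K` (for a strictly positive definite kernel there is
exactly one). -/
def param (K : Matrix ℕ ℕ ℂ) : ℕ → ℕ → ℂ := Classical.epsilon (IsParamFamily K)

/-! ### Orthogonal polynomials -/

/-- The orthogonal polynomials of `φ`: the Gram–Schmidt procedure applied to the monomials `X_σ`
in the order of their words, with positive leading coefficients. -/
def orthoPoly {N : ℕ} [NeZero N] {A : Set (Poly2N N)} (φ : QuotAlg A →ₗ[ℂ] ℂ) (n : ℕ) : PolyN N :=
  let e : PolyN N := mono (wordAt N n) -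
    ∑ i : Fin n, form φ (mono (wordAt N n)) (orthoPoly φ i) • orthoPoly φ i
  (((Real.sqrt (form φ e e).re)⁻¹ : ℝ) : ℂ) • e
termination_by n
decreasing_by all_goals exact i.2

/-- The polynomial `X_k φ_σ` attached to the word `kσ` (and `0` for the empty word). -/
def shiftedPoly {N : ℕ} [NeZero N] {A : Set (Poly2N N)} (φ : QuotAlg A →ₗ[ℂ] ℂ) :
    List (Fin N) → PolyN N
  | [] => 0
  | k :: σ => var k * orthoPoly φ (wordIndex (FreeMonoid.ofList σ))

/-- The polynomials `φ_n^♯`: `φ_∅^♯ = 1`, and, with `γ_{kσ} = γ_{∅,kσ}`,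
`φ_{kσ}^♯ = d_{kσ}⁻¹ (- conj γ_{kσ} X_k φ_σ + φ_{kσ-1}^♯)`, where `kσ - 1` is the predecessor
of the word `kσ`. -/
def sharpPoly {N : ℕ} [NeZero N] {A : Set (Poly2N N)} (φ : QuotAlg A →ₗ[ℂ] ℂ) : ℕ → PolyN N
  | 0 => 1
  | n + 1 => (defect (param (kernel φ) 0 (n + 1)))⁻¹ •
      (-(star (param (kernel φ) 0 (n + 1)) • shiftedPoly φ (wordAt N (n + 1)).toList) +
        sharpPoly φ n)

/-! ### The spectral factor of a positive definite kernel on `ℕ` -/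

/-- Lower triangular arrays with entries in the Hilbert spaces `F k` (operators from `ℂ` to `F k`
are identified with elements of `F k`), with square summable columns. -/
structure TriArray (F : ℕ → Type) [∀ k, NormedAddCommGroup (F k)]
    [∀ k, InnerProductSpace ℂ (F k)] where
  entry : ∀ k : ℕ, ℕ → F k
  lower : ∀ k j, k < j → entry k j = 0
  memlp : ∀ j, Memℓp (fun k => entry k j) 2

variable {F : ℕ → Type} [∀ k, NormedAddCommGroup (F k)] [∀ k, InnerProductSpace ℂ (F k)]

/-- The `j`-th column, an element of the Hilbert space direct sum of the `F k`. -/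
def TriArray.col (T : TriArray F) (j : ℕ) : lp F 2 := ⟨fun k => T.entry k j, T.memlp j⟩

/-- The kernel `(k, j) ↦ c_k* c_j` of an array with columns `c_j`. -/
def TriArray.toKernel (T : TriArray F) : Matrix ℕ ℕ ℂ := fun k j => inner ℂ (T.col k) (T.col j)

/-- The array is outer: for all `k` the columns `c_j`, `j ≥ k`, are total in the direct sum
of the `F i`, `i ≥ k`. -/
def TriArray.IsOuter (T : TriArray F) : Prop :=
  ∀ (k : ℕ) (x : lp F 2), (∀ i < k, x i = 0) →
    x ∈ (Submodule.span ℂ (T.col '' Set.Ici k)).topologicalClosure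

end

/-- `Θ` is the spectral factor of `K`: an outer lower triangular array with non-negative diagonal,
the Hilbert spaces being `{0}` or `ℂ`, whose kernel is below `K` and is the largest among the
kernels below `K` of outer arrays. -/
def IsSpectralFactor (K : Matrix ℕ ℕ ℂ) (Θ : Matrix ℕ ℕ ℂ) : Prop :=
  ∃ (F : ℕ → Submodule ℂ ℂ) (T : TriArray (fun k => F k)),
    (∀ k j, Θ k j = (T.entry k j : ℂ)) ∧ (∀ k, 0 ≤ Θ k k) ∧ T.IsOuter ∧
    (K - T.toKernel).PosSemidef ∧
    ∀ (F' : ℕ → Type) [∀ k, NormedAddCommGroup (F' k)] [∀ k, InnerProductSpace ℂ (F' k)]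
      [∀ k, CompleteSpace (F' k)] (T' : TriArray F'),
      T'.IsOuter → (K - T'.toKernel).PosSemidef → (T.toKernel - T'.toKernel).PosSemidef

/-- The spectral factor of `K` (for a positive definite kernel there is exactly one). -/
noncomputable def spectralFactor (K : Matrix ℕ ℕ ℂ) : Matrix ℕ ℕ ℂ :=
  Classical.epsilon (IsSpectralFactor K)

/-- `K` is in the Szegő class: the diagonal entries of its spectral factor are positive. -/
def SzegoClass (K : Matrix ℕ ℕ ℂ) : Prop :=
  ∃ Θ, IsSpectralFactor K Θ ∧ ∀ n, 0 < Θ n n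

/-! ### Formal power series in non-commuting variables -/

/-- Formal power series in the non-commuting variables `X_1, …, X_N`. -/
abbrev Series (N : ℕ) := Word N → ℂ

/-- The series `1`. -/
def oneSeries (N : ℕ) : Series N := fun w => if w.length = 0 then 1 else 0

/-- The product of series: the coefficient at `w` is the sum of `f u * g v` over all
factorizations `w = u v`. -/
def mulSeries {N : ℕ} (f g : Series N) : Series N := fun w =>
  ∑ i ∈ Finset.range (w.length + 1),
    f (FreeMonoid.ofList (w.toList.take i)) * g (FreeMonoid.ofList (w.toList.drop i))

/-- A polynomial as a series. -/
def toSeries {N : ℕ} (P : PolyN N) : Series N := fun w => P.coeff w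

/-- `g` is the (two-sided) inverse of the series `f`. -/
def IsInverse {N : ℕ} (f g : Series N) : Prop :=
  mulSeries f g = oneSeries N ∧ mulSeries g f = oneSeries N

/-- The lower triangular array of a series `θ`: the entry at the words `(σ, τ)` is `θ α` if
`σ = τ α`, and `0` if `τ` is not a prefix of `σ`. -/
def seriesArray {N : ℕ} [NeZero N] (θ : Series N) : Matrix ℕ ℕ ℂ := fun m n =>
  if (wordAt N n).toList <+: (wordAt N m).toList then
    θ (FreeMonoid.ofList ((wordAt N m).toList.drop (wordAt N n).length))
  else 0

end TreeSzego

open TreeSzego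

/-
Polynomials in `X_1, …, X_N` with `⟨P, Q⟩_φ` form an inner product space with basis the monomials,
`K_φ` is their Gram matrix, and left multiplication by `X_k` is isometric. The Szegő recursion for
normalized orthogonal components of basis vectors identifies the parameters with inner products of
such components, and hence `φ_n` and `φ_n^♯` with the components of `X_{σ_n}` orthogonal to all
earlier monomials and of `1` orthogonal to `X_{σ_1}, …, X_{σ_n}`.

The spectral factor is a contraction `C` from this space to `ℓ²` whose `m`-th diagonal entry is the
distance from `X_{σ_m}` to the span of the later monomials: it is at most the distance because `C`
is a contraction, and maximality tested on arrays with one nonzero row gives equality. So for every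
word `s = σ_m` the `m`-th coordinate of `C (X_s φ_n^♯)` tends to `1`; since `‖X_s φ_n^♯‖ = 1`,
`C (X_s φ_n^♯)` tends to the `m`-th unit vector of `ℓ²`, and `⟪X_s φ_n^♯, x⟫` to the `m`-th
coordinate of `C x` for every `x`. Isometry of the `X_k` turns the second limit into the shift
structure of `Θ_φ`, and the first one, for `s = ∅`, says that the series `φ_n^♯ Θ_φ` tends to `1`.
The orthonormal `φ_n` tend weakly to `0`, and the triangular system given by the rows of `Θ_φ`,
whose diagonal does not vanish, transfers this to their coefficients.
-/

namespace TreeSzego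

/-! ### Unit components of basis vectors -/

section UnitComponent

variable {ι E : Type*} [NormedAddCommGroup E] [InnerProductSpace ℂ E]

/-- `x` is the normalized component of the basis vector `v p` orthogonal to the vectors `v i`,
`i ∈ s`: a unit vector of their span with positive coefficient at `v p`. These properties determine
`x`; the projection onto the span of the `v i` is avoided because `s` may be infinite. -/
structure IsUnitComponent (v : Module.Basis ι ℂ E) (s : Set ι) (p : ι) (x : E) : Prop where
  norm_eq : ‖x‖ = 1
  repr_eq_zero : ∀ i ∉ s, i ≠ p → v.repr x i = 0
  repr_pos : 0 < v.repr x p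
  inner_eq_zero : ∀ i ∈ s, inner ℂ (v i) x = 0

variable {v : Module.Basis ι ℂ E} {s : Set ι} {p q : ι} {f b x y : E}

theorem inner_eq_star_repr_mul (v : Module.Basis ι ℂ E)
    (h : ∀ i ≠ p, v.repr x i = 0 ∨ inner ℂ (v i) y = 0) :
    inner ℂ x y = star (v.repr x p) * inner ℂ (v p) y := by
  conv_lhs => rw [← v.linearCombination_repr x]
  rw [Finsupp.linearCombination_apply, Finsupp.sum_inner, Finsupp.sum_eq_single p,
    inner_smul_left, starRingEnd_apply]
  · intro i _ hi
    rcases h i hi with h | h <;> simp [h]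
  · simp

namespace IsUnitComponent

theorem star_repr (hx : IsUnitComponent v s p x) : star (v.repr x p) = v.repr x p :=
  IsSelfAdjoint.of_nonneg hx.repr_pos.le

theorem inner_left (hx : IsUnitComponent v s p x) (hy : ∀ i ∈ s, inner ℂ (v i) y = 0) :
    inner ℂ x y = v.repr x p * inner ℂ (v p) y := by
  rw [inner_eq_star_repr_mul v (p := p), hx.star_repr]
  intro i hi
  by_cases his : i ∈ s
  · exact .inr (hy i his)
  · exact .inl (hx.repr_eq_zero i his hi)

theorem repr_mul_inner (hx : IsUnitComponent v s p x) : v.repr x p * inner ℂ (v p) x = 1 := by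
  rw [← hx.inner_left hx.inner_eq_zero, inner_self_eq_one_of_norm_eq_one hx.norm_eq]

theorem notMem (hx : IsUnitComponent v s p x) : p ∉ s := fun hp ↦ by
  simpa [hx.inner_eq_zero p hp] using hx.repr_mul_inner

theorem unique (hx : IsUnitComponent v s p x) (hy : IsUnitComponent v s p y) : x = y := by
  have key {x y : E} (hx : IsUnitComponent v s p x) (hy : IsUnitComponent v s p y) :
      v.repr y p * inner ℂ x y = v.repr x p := by
    rw [hx.inner_left hy.inner_eq_zero]
    linear_combination v.repr x p * hy.repr_mul_inner
  have hyx : v.repr x p * inner ℂ x y = v.repr y p := by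
    rw [← hx.star_repr, ← hy.star_repr, ← key hy hx, star_mul', Complex.star_def, inner_conj_symm]
  have hpos : v.repr x p + v.repr y p ≠ 0 := (add_pos hx.repr_pos hy.repr_pos).ne'
  refine (inner_eq_one_iff_of_norm_eq_one (𝕜 := ℂ) hx.norm_eq hy.norm_eq).1 ?_
  refine mul_left_cancel₀ hpos ?_
  linear_combination key hx hy + hyx

theorem norm_inner_lt_one (hf : IsUnitComponent v s q f) (hb : IsUnitComponent v s p b)
    (hpq : p ≠ q) : ‖inner ℂ b f‖ < 1 := by
  have hle : ‖inner ℂ b f‖ ≤ 1 := by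
    simpa [hb.norm_eq, hf.norm_eq] using norm_inner_le_norm (𝕜 := ℂ) b f
  refine hle.lt_of_ne fun h ↦ ?_
  have hb0 : b ≠ 0 := norm_ne_zero_iff.1 (by simp [hb.norm_eq])
  have hf0 : f ≠ 0 := norm_ne_zero_iff.1 (by simp [hf.norm_eq])
  obtain ⟨r, hr, rfl⟩ := (norm_inner_eq_norm_iff hb0 hf0).1
    (h.trans (by rw [hb.norm_eq, hf.norm_eq, mul_one]))
  have := hf.repr_eq_zero p hb.notMem hpq
  simp [hr, hb.repr_pos.ne'] at this

end IsUnitComponent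

theorem isUnitComponent_of_mem_span (hp : p ∉ s) (hy : y ∈ Submodule.span ℂ (v '' s))
    (horth : ∀ i ∈ s, inner ℂ (v i) (v p - y) = 0) :
    IsUnitComponent v s p ((‖v p - y‖ : ℂ)⁻¹ • (v p - y)) := by
  have hysupp : ∀ i ∉ s, v.repr y i = 0 := fun i hi ↦
    Finsupp.notMem_support_iff.1 fun h ↦ hi (v.repr_support_subset_of_mem_span s hy h)
  have hne : v p - y ≠ 0 := fun h ↦ by
    simpa [hysupp p hp] using congrArg (fun z ↦ v.repr z p) h
  have hpos : 0 < ‖v p - y‖ := norm_pos_iff.2 hne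
  refine ⟨norm_smul_inv_norm hne, fun i hi hip ↦ ?_, ?_, fun i hi ↦ ?_⟩
  · simp [hysupp i hi, hip]
  · rw [map_smul, map_sub, v.repr_self, Finsupp.smul_apply, Finsupp.sub_apply, hysupp p hp,
      Finsupp.single_eq_same, sub_zero, smul_eq_mul, mul_one, ← Complex.ofReal_inv,
      Complex.zero_lt_real]
    exact inv_pos.2 hpos
  · rw [inner_smul_right, horth i hi, mul_zero]

theorem isUnitComponent_gramSchmidtNormed [LinearOrder ι] [LocallyFiniteOrderBot ι]
    [WellFoundedLT ι] (v : Module.Basis ι ℂ E) (p : ι) :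
    IsUnitComponent v (Set.Iio p) p (InnerProductSpace.gramSchmidtNormed ℂ v p) := by
  have h := (sub_sub_cancel (v p) (InnerProductSpace.gramSchmidt ℂ v p)).symm
  rw [InnerProductSpace.gramSchmidtNormed, h]
  refine isUnitComponent_of_mem_span Set.self_notMem_Iio ?_ fun i hi ↦ ?_
  · rw [InnerProductSpace.gramSchmidt_def, sub_sub_cancel]
    refine Submodule.sum_mem _ fun i hi ↦ ?_
    rw [← InnerProductSpace.span_gramSchmidt_Iio]
    refine Submodule.span_mono ?_ (Submodule.starProjection_apply_mem _ _)
    simpa using ⟨i, Finset.mem_Iio.1 hi, rfl⟩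
  · rw [← h, ← inner_conj_symm, InnerProductSpace.gramSchmidt_inv_triangular ℂ v hi, map_zero]

theorem defect_mul_self {γ : ℂ} (hγ : ‖γ‖ < 1) : defect γ * defect γ = 1 - γ * star γ := by
  rw [defect, ← Complex.ofReal_mul, Real.mul_self_sqrt (by nlinarith [norm_nonneg γ]),
    Complex.star_def, Complex.mul_conj, Complex.normSq_eq_norm_sq, Complex.ofReal_sub,
    Complex.ofReal_one]

theorem defect_pos {γ : ℂ} (hγ : ‖γ‖ < 1) : 0 < defect γ :=
  Complex.zero_lt_real.2 (Real.sqrt_pos.2 (by nlinarith [norm_nonneg γ]))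

theorem defect_star (γ : ℂ) : defect (star γ) = defect γ := by
  rw [defect, defect, norm_star]

theorem norm_sub_inner_smul (hf : ‖f‖ = 1) (hb : ‖b‖ = 1) :
    (‖f - inner ℂ b f • b‖ : ℂ) = defect (inner ℂ b f) := by
  have h : inner ℂ (f - inner ℂ b f • b) (f - inner ℂ b f • b)
      = ((1 - ‖inner ℂ b f‖ ^ 2 : ℝ) : ℂ) := by
    have hbf : inner ℂ f b * inner ℂ b f = (‖inner ℂ b f‖ : ℂ) ^ 2 := by
      rw [← inner_conj_symm f b, Complex.conj_mul']
    simp only [inner_sub_left, inner_sub_right, inner_smul_left, inner_smul_right, inner_conj_symm,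
      inner_self_eq_one_of_norm_eq_one hf, inner_self_eq_one_of_norm_eq_one hb]
    push_cast
    linear_combination -hbf
  rw [defect, norm_eq_sqrt_re_inner (𝕜 := ℂ), h]
  rfl

/-- The Szegő step: modulo the span of `v '' s` the vector `b` is a multiple of `v p`, so that
removing the component along `b` removes the component along `v p`. -/
theorem IsUnitComponent.insert (hf : IsUnitComponent v s q f) (hb : IsUnitComponent v s p b)
    (hpq : p ≠ q) :
    IsUnitComponent v (insert p s) q ((defect (inner ℂ b f))⁻¹ • (f - inner ℂ b f • b)) := by
  have hd := defect_pos (hf.norm_inner_lt_one hb hpq)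
  refine ⟨?_, fun i hi hiq ↦ ?_, ?_, ?_⟩
  · rw [← norm_sub_inner_smul hf.norm_eq hb.norm_eq]
    refine norm_smul_inv_norm fun h ↦ hd.ne' ?_
    rw [← norm_sub_inner_smul hf.norm_eq hb.norm_eq, h, norm_zero, Complex.ofReal_zero]
  · obtain ⟨hip, his⟩ := not_or.1 hi
    simp [hf.repr_eq_zero i his hiq, hb.repr_eq_zero i his hip]
  · simpa [hb.repr_eq_zero q hf.notMem hpq.symm] using mul_pos (inv_pos.2 hd) hf.repr_pos
  · rintro i (rfl | his) <;> rw [inner_smul_right, inner_sub_right, inner_smul_right]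
    · rw [hb.inner_left hf.inner_eq_zero]
      linear_combination -(defect (v.repr b i * inner ℂ (v i) f))⁻¹ * inner ℂ (v i) f *
        hb.repr_mul_inner
    · rw [hf.inner_eq_zero i his, hb.inner_eq_zero i his]
      ring

/-- The normalized component of `v p` orthogonal to the vectors `v i`, `i ∈ s` (meaningful only for
`p ∉ s`). -/
noncomputable def unitComponent (v : Module.Basis ι ℂ E) (s : Finset ι) (p : ι) : E :=
  haveI : FiniteDimensional ℂ (Submodule.span ℂ (v '' s)) :=
    .span_of_finite ℂ (s.finite_toSet.image v)
  let x := v p - (Submodule.span ℂ (v '' s)).starProjection (v p)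
  (‖x‖ : ℂ)⁻¹ • x

theorem isUnitComponent_unitComponent (v : Module.Basis ι ℂ E) {s : Finset ι} (hp : p ∉ s) :
    IsUnitComponent v s p (unitComponent v s p) := by
  have : FiniteDimensional ℂ (Submodule.span ℂ (v '' s)) :=
    .span_of_finite ℂ (s.finite_toSet.image v)
  refine isUnitComponent_of_mem_span (by simpa using hp)
    (Submodule.starProjection_apply_mem _ _) fun i hi ↦ ?_
  exact Submodule.inner_right_of_mem_orthogonal (Submodule.subset_span (Set.mem_image_of_mem v hi))
    (Submodule.sub_starProjection_mem_orthogonal _)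

theorem unitComponent_insert [DecidableEq ι] (v : Module.Basis ι ℂ E) {s : Finset ι} (hp : p ∉ s)
    (hq : q ∉ s) (hpq : p ≠ q) :
    unitComponent v (insert p s) q =
      (defect (inner ℂ (unitComponent v s p) (unitComponent v s q)))⁻¹ •
        (unitComponent v s q -
          inner ℂ (unitComponent v s p) (unitComponent v s q) • unitComponent v s p) := by
  refine (isUnitComponent_unitComponent v (by simp [hq, hpq.symm])).unique ?_
  rw [Finset.coe_insert]
  exact (isUnitComponent_unitComponent v hq).insert (isUnitComponent_unitComponent v hp) hpq

end UnitComponent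

/-! ### Parameters of a Gram kernel -/

section Parameters

theorem rotProd_apply_of_lt (g : ℕ → ℕ → ℂ) (k : ℕ) {n m : ℕ} (h : n < m) (a : ℕ → ℂ) :
    rotProd g k n a m = a m := by
  induction n generalizing a with
  | zero => rfl
  | succ n ih =>
    rw [rotProd, ih (by omega), rot, if_neg (by omega), if_neg (by omega)]

theorem latticeU_single_apply_of_lt (g : ℕ → ℕ → ℂ) (k : ℕ) {n m : ℕ} (h : n < m) :
    latticeU g k n (Pi.single 0 1) m = 0 := by
  induction n generalizing k with
  | zero => rw [latticeU, Pi.single_eq_of_ne (by omega)]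
  | succ n ih => rw [latticeU, rotProd_apply_of_lt g k h, ih _ (by omega)]

theorem latticeU_single_apply_self_ne_zero {g : ℕ → ℕ → ℂ} (hg : ∀ k j, k < j → ‖g k j‖ < 1)
    (k n : ℕ) : latticeU g k n (Pi.single 0 1) n ≠ 0 := by
  induction n generalizing k with
  | zero => simp [latticeU]
  | succ n ih =>
    have hlast := latticeU_single_apply_of_lt g (k + 1) (Nat.lt_succ_self n)
    have hd : defect (g k (k + n + 1)) ≠ 0 := (defect_pos (hg _ _ (by omega))).ne'
    simp [latticeU, rotProd, rotProd_apply_of_lt g k (Nat.lt_succ_self n), rot, hlast, hd, ih]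

theorem rotProd_congr {g g' : ℕ → ℕ → ℂ} {k n : ℕ}
    (h : ∀ i < n, g k (k + i + 1) = g' k (k + i + 1)) : rotProd g k n = rotProd g' k n := by
  induction n with
  | zero => rfl
  | succ n ih =>
    funext a
    rw [rotProd, rotProd, h n (by omega), ih fun i hi ↦ h i (by omega)]

theorem latticeU_congr {g g' : ℕ → ℕ → ℂ} {k n : ℕ}
    (h : ∀ i j, i < j → j ≤ i + n → g i j = g' i j) : latticeU g k n = latticeU g' k n := by
  induction n generalizing k with
  | zero => rfl
  | succ n ih =>
    funext a
    rw [latticeU, latticeU, ih fun i j h1 h2 ↦ h i j h1 (by omega),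
      rotProd_congr fun i _ ↦ h k _ (by omega) (by omega)]

theorem eq_of_rotProd_apply_zero_eq {g : ℕ → ℕ → ℂ} (hg : ∀ k j, k < j → ‖g k j‖ < 1)
    (k n : ℕ) {a b : ℕ → ℂ} (hab : ∀ i < n, a i = b i)
    (h : rotProd g k n a 0 = rotProd g k n b 0) : a n = b n := by
  induction n generalizing a b with
  | zero => exact h
  | succ n ih =>
    have hrot : rot (g k (k + n + 1)) n a n = rot (g k (k + n + 1)) n b n := by
      refine ih (fun i hi ↦ ?_) h
      simp only [rot, if_neg (show i ≠ n by omega), if_neg (show i ≠ n + 1 by omega),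
        hab i (by omega)]
    simp only [rot, if_true, hab n (by omega), add_right_inj] at hrot
    exact mul_left_cancel₀ (defect_pos (hg _ _ (by omega))).ne' hrot

/-- With the parameters `g i j`, `j ≤ i + n`, known, `latticeU g k (n + 1)` depends on `g` only
through the entry `g k (k + n + 1)`, and its `(0, 0)` entry is an injective function of it. -/
theorem eq_of_latticeU_single_apply_zero_eq {g g' : ℕ → ℕ → ℂ}
    (hg' : ∀ k j, k < j → ‖g' k j‖ < 1) {k n : ℕ}
    (hgg' : ∀ i j, i < j → j ≤ i + n → g i j = g' i j)
    (h : latticeU g k (n + 1) (Pi.single 0 1) 0 = latticeU g' k (n + 1) (Pi.single 0 1) 0) :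
    g k (k + n + 1) = g' k (k + n + 1) := by
  rw [latticeU, latticeU, latticeU_congr hgg', rotProd, rotProd,
    rotProd_congr fun i hi ↦ hgg' _ _ (by omega) (by omega)] at h
  have hrot := eq_of_rotProd_apply_zero_eq hg' k n (fun i hi ↦ by
    simp only [rot, if_neg (show i ≠ n by omega), if_neg (show i ≠ n + 1 by omega)]) h
  simp only [rot, if_true, latticeU_single_apply_of_lt g' (k + 1) (Nat.lt_succ_self n), mul_zero,
    add_zero] at hrot
  exact mul_right_cancel₀ (latticeU_single_apply_self_ne_zero hg' (k + 1) n) hrot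

theorem IsParamFamily.unique {K : Matrix ℕ ℕ ℂ} (hK : ∀ k, 0 < (K k k).re) {g g' : ℕ → ℕ → ℂ}
    (hg : IsParamFamily K g) (hg' : IsParamFamily K g') : g = g' := by
  obtain ⟨hg0, -, hgK⟩ := hg
  obtain ⟨hg0', hlt', hgK'⟩ := hg'
  have hsqrt (j : ℕ) : ((Real.sqrt (K j j).re : ℝ) : ℂ) ≠ 0 :=
    Complex.ofReal_ne_zero.2 (Real.sqrt_pos.2 (hK j)).ne'
  have hlattice (k n : ℕ) :
      latticeU g k n (Pi.single 0 1) 0 = latticeU g' k n (Pi.single 0 1) 0 :=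
    mul_left_cancel₀ (hsqrt k) (mul_right_cancel₀ (hsqrt (k + n)) ((hgK k n).symm.trans (hgK' k n)))
  have heq (n : ℕ) : ∀ i j, i < j → j ≤ i + n → g i j = g' i j := by
    induction n with
    | zero => intro i j hij hji; omega
    | succ n ih =>
      intro i j hij hji
      rcases hji.lt_or_eq with hji | rfl
      · exact ih i j hij (by omega)
      · exact eq_of_latticeU_single_apply_zero_eq hlt' ih (hlattice i (n + 1))
  funext k j
  rcases lt_or_ge k j with h | h
  · exact heq j k j h (by omega)
  · rw [hg0 k j h, hg0' k j h]

variable {E : Type*} [NormedAddCommGroup E] [InnerProductSpace ℂ E] (v : Module.Basis ℕ ℂ E)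

/-- The vector `f_{k,j}`: the normalized component of `v j` orthogonal to `v k, …, v (j - 1)`. -/
noncomputable def forwardVec (k j : ℕ) : E := unitComponent v (Finset.Ico k j) j

/-- The vector `b_{k,j}`: the normalized component of `v k` orthogonal to `v (k + 1), …, v j`. -/
noncomputable def backwardVec (k j : ℕ) : E := unitComponent v (Finset.Ioc k j) k

/-- The parameter `γ_{k,j}` in terms of vectors: the cosine `⟪b_{k,j-1}, f_{k+1,j}⟫`. As in
`IsParamFamily`, the entries with `j ≤ k` are set to `0`. -/
noncomputable def szegoParam (k j : ℕ) : ℂ :=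
  if k < j then inner ℂ (unitComponent v (Finset.Ioo k j) k) (unitComponent v (Finset.Ioo k j) j)
  else 0

theorem isUnitComponent_forwardVec (k j : ℕ) :
    IsUnitComponent v (Finset.Ico k j) j (forwardVec v k j) :=
  isUnitComponent_unitComponent v (by simp)

theorem isUnitComponent_backwardVec (k j : ℕ) :
    IsUnitComponent v (Finset.Ioc k j) k (backwardVec v k j) :=
  isUnitComponent_unitComponent v (by simp)

theorem forwardVec_succ_succ (k j : ℕ) :
    forwardVec v (k + 1) (j + 1) = unitComponent v (Finset.Ioo k (j + 1)) (j + 1) := by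
  rw [forwardVec, Finset.Ico_add_one_left_eq_Ioo]

theorem backwardVec_eq_Ioo (k j : ℕ) :
    backwardVec v k j = unitComponent v (Finset.Ioo k (j + 1)) k := by
  rw [backwardVec, Finset.Ioo_add_one_right_eq_Ioc]

theorem szegoParam_succ {k j : ℕ} (hkj : k ≤ j) :
    szegoParam v k (j + 1) = inner ℂ (backwardVec v k j) (forwardVec v (k + 1) (j + 1)) := by
  rw [szegoParam, if_pos (Nat.lt_add_one_of_le hkj), backwardVec_eq_Ioo, forwardVec_succ_succ]

theorem norm_szegoParam_lt_one {k j : ℕ} (hkj : k < j) : ‖szegoParam v k j‖ < 1 := by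
  rw [szegoParam, if_pos hkj]
  exact (isUnitComponent_unitComponent v (by simp)).norm_inner_lt_one
    (isUnitComponent_unitComponent v (by simp)) hkj.ne

theorem forwardVec_succ {k j : ℕ} (hkj : k ≤ j) :
    forwardVec v k (j + 1) = (defect (szegoParam v k (j + 1)))⁻¹ •
      (forwardVec v (k + 1) (j + 1) - szegoParam v k (j + 1) • backwardVec v k j) := by
  rw [szegoParam_succ v hkj, forwardVec_succ_succ, backwardVec_eq_Ioo, forwardVec,
    ← Finset.Ioo_insert_left (Nat.lt_add_one_of_le hkj),
    unitComponent_insert v (by simp) (by simp) (by omega)]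

theorem backwardVec_succ {k j : ℕ} (hkj : k ≤ j) :
    backwardVec v k (j + 1) = (defect (szegoParam v k (j + 1)))⁻¹ •
      (backwardVec v k j - star (szegoParam v k (j + 1)) • forwardVec v (k + 1) (j + 1)) := by
  rw [← defect_star, szegoParam_succ v hkj, Complex.star_def, inner_conj_symm,
    forwardVec_succ_succ, backwardVec_eq_Ioo v k j, backwardVec,
    ← unitComponent_insert v (by simp) (by simp) (by omega),
    Finset.Ioo_insert_right (Nat.lt_add_one_of_le hkj)]

/-- Together with `backwardVec_succ_eq_sub` this says that a rotation of the form `rot` takes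
`f_{k,j+1}`, `b_{k,j+1}` to `b_{k,j}`, `f_{k+1,j+1}`. -/
theorem forwardVec_succ_left {k j : ℕ} (hkj : k ≤ j) :
    forwardVec v (k + 1) (j + 1) = szegoParam v k (j + 1) • backwardVec v k j +
      defect (szegoParam v k (j + 1)) • forwardVec v k (j + 1) := by
  have hd := (defect_pos (norm_szegoParam_lt_one v (Nat.lt_add_one_of_le hkj))).ne'
  rw [forwardVec_succ v hkj, smul_inv_smul₀ hd, add_sub_cancel]

theorem backwardVec_succ_eq_sub {k j : ℕ} (hkj : k ≤ j) :
    backwardVec v k (j + 1) = defect (szegoParam v k (j + 1)) • backwardVec v k j -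
      star (szegoParam v k (j + 1)) • forwardVec v k (j + 1) := by
  have hlt := norm_szegoParam_lt_one v (Nat.lt_add_one_of_le hkj)
  refine smul_right_injective E (defect_pos hlt).ne' ?_
  beta_reduce
  rw [backwardVec_succ v hkj, smul_inv_smul₀ (defect_pos hlt).ne', forwardVec_succ_left v hkj,
    smul_sub, smul_smul (defect _) (defect _), defect_mul_self hlt]
  module

theorem sum_rotProd_smul_forwardVec (k n : ℕ) (a : ℕ → ℂ) :
    ∑ i ∈ Finset.range (n + 1), rotProd (szegoParam v) k n a i • forwardVec v k (k + i) =
      ∑ i ∈ Finset.range n, a i • forwardVec v (k + 1) (k + 1 + i) +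
        a n • backwardVec v k (k + n) := by
  induction n generalizing a with
  | zero => simp [rotProd, forwardVec, backwardVec]
  | succ n ih =>
    have hrot : ∀ i ∈ Finset.range n, rot (szegoParam v k (k + n + 1)) n a i = a i := fun i hi ↦ by
      have := Finset.mem_range.1 hi
      rw [rot, if_neg (by omega), if_neg (by omega)]
    rw [Finset.sum_range_succ, rotProd, ih, rotProd_apply_of_lt _ _ (Nat.lt_succ_self n),
      Finset.sum_range_succ _ n, Finset.sum_congr rfl fun i hi ↦ by rw [hrot i hi],
      show k + 1 + n = k + n + 1 by omega, show k + (n + 1) = k + n + 1 by omega,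
      forwardVec_succ_left v (Nat.le_add_right k n),
      backwardVec_succ_eq_sub v (Nat.le_add_right k n)]
    simp only [rot, if_true, if_neg (show n + 1 ≠ n by omega)]
    module

theorem sum_latticeU_smul_forwardVec (k n : ℕ) :
    ∑ i ∈ Finset.range (n + 1),
        latticeU (szegoParam v) k n (Pi.single 0 1) i • forwardVec v k (k + i) =
      forwardVec v (k + n) (k + n) := by
  induction n generalizing k with
  | zero => simp [latticeU]
  | succ n ih =>
    rw [latticeU, sum_rotProd_smul_forwardVec, ih,
      latticeU_single_apply_of_lt _ _ (Nat.lt_succ_self n), zero_smul, add_zero,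
      show k + 1 + n = k + (n + 1) by omega]

theorem inner_forwardVec_self_self (k n : ℕ) :
    inner ℂ (forwardVec v k k) (forwardVec v (k + n) (k + n)) =
      latticeU (szegoParam v) k n (Pi.single 0 1) 0 := by
  have hk := isUnitComponent_forwardVec v k k
  rw [← sum_latticeU_smul_forwardVec, inner_sum, Finset.sum_eq_single 0]
  · rw [inner_smul_right, add_zero, inner_self_eq_one_of_norm_eq_one hk.norm_eq, mul_one]
  · intro i _ hi
    have horth : inner ℂ (v k) (forwardVec v k (k + i)) = 0 :=
      (isUnitComponent_forwardVec v k (k + i)).inner_eq_zero k (by simp; omega)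
    rw [inner_smul_right, hk.inner_left (by simp), horth, mul_zero, mul_zero]
  · simp

theorem norm_smul_forwardVec_self (j : ℕ) : (‖v j‖ : ℂ) • forwardVec v j j = v j := by
  have h0 : (‖v j‖ : ℂ) ≠ 0 := by simpa using v.ne_zero j
  simp [forwardVec, unitComponent, smul_inv_smul₀ h0]

theorem isParamFamily_szegoParam : IsParamFamily (Matrix.gram ℂ v) (szegoParam v) := by
  refine ⟨fun k j h ↦ if_neg h.not_gt, fun k j h ↦ norm_szegoParam_lt_one v h, fun k n ↦ ?_⟩
  have hsqrt (j : ℕ) : Real.sqrt (Matrix.gram ℂ v j j).re = ‖v j‖ :=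
    (norm_eq_sqrt_re_inner (𝕜 := ℂ) (v j)).symm
  rw [hsqrt, hsqrt, ← inner_forwardVec_self_self, Matrix.gram_apply]
  conv_lhs => rw [← norm_smul_forwardVec_self v k, ← norm_smul_forwardVec_self v (k + n)]
  rw [inner_smul_left, inner_smul_right, Complex.conj_ofReal]
  ring

theorem param_gram : param (Matrix.gram ℂ v) = szegoParam v := by
  have hspec := Classical.epsilon_spec ⟨_, isParamFamily_szegoParam v⟩
  refine hspec.unique (fun k ↦ ?_) (isParamFamily_szegoParam v)
  exact re_inner_self_pos (𝕜 := ℂ) |>.2 (v.ne_zero k)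

end Parameters

/-! ### Contractions and functionals -/

section Contraction

variable {ι α E H H' : Type*} [NormedAddCommGroup E] [InnerProductSpace ℂ E]
  [NormedAddCommGroup H] [InnerProductSpace ℂ H] [NormedAddCommGroup H'] [InnerProductSpace ℂ H']

theorem sum_star_mul_gram_mul (a : ι → E) (x : ι →₀ ℂ) :
    (x.sum fun i xi ↦ x.sum fun j xj ↦ star xi * Matrix.gram ℂ a i j * xj) =
      ((‖Finsupp.linearCombination ℂ a x‖ ^ 2 : ℝ) : ℂ) := by
  rw [Complex.ofReal_pow]
  refine Eq.trans ?_ (inner_self_eq_norm_sq_to_K (𝕜 := ℂ) (Finsupp.linearCombination ℂ a x))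
  rw [Finsupp.linearCombination_apply, Finsupp.sum_inner]
  refine Finsupp.sum_congr fun i _ ↦ ?_
  rw [Finsupp.inner_sum]
  refine Finsupp.sum_congr fun j _ ↦ ?_
  rw [Matrix.gram_apply, inner_smul_left, inner_smul_right, Complex.star_def]
  ring

theorem posSemidef_gram_sub_gram_iff (v : Module.Basis ι ℂ E) (A : E →ₗ[ℂ] H) (B : E →ₗ[ℂ] H') :
    (Matrix.gram ℂ (A ∘ v) - Matrix.gram ℂ (B ∘ v)).PosSemidef ↔ ∀ x, ‖B x‖ ≤ ‖A x‖ := by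
  have key (x : ι →₀ ℂ) : (0 ≤ x.sum fun i xi ↦ x.sum fun j xj ↦
      star xi * (Matrix.gram ℂ (A ∘ v) - Matrix.gram ℂ (B ∘ v)) i j * xj) ↔
      ‖B (Finsupp.linearCombination ℂ v x)‖ ≤ ‖A (Finsupp.linearCombination ℂ v x)‖ := by
    simp only [Matrix.sub_apply, mul_sub, sub_mul, Finsupp.sum_sub]
    rw [sum_star_mul_gram_mul, sum_star_mul_gram_mul, ← Complex.ofReal_sub, Complex.zero_le_real,
      sub_nonneg, pow_le_pow_iff_left₀ (norm_nonneg _) (norm_nonneg _) two_ne_zero,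
      Finsupp.apply_linearCombination, Finsupp.apply_linearCombination]
  refine ⟨fun h x ↦ ?_, fun h ↦ ⟨(Matrix.isHermitian_gram _ _).sub (Matrix.isHermitian_gram _ _),
    fun x ↦ (key x).2 (h _)⟩⟩
  rw [← v.linearCombination_repr x]
  exact (key _).1 (h.2 _)

theorem norm_inner_sub_inner_sq_le (C : E →ₗ[ℂ] H) (hC : ∀ x, ‖C x‖ ≤ ‖x‖) (x y : E) :
    ‖inner ℂ x y - inner ℂ (C x) (C y)‖ ^ 2 ≤ (‖x‖ ^ 2 - ‖C x‖ ^ 2) * ‖y‖ ^ 2 := by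
  -- the Cauchy–Schwarz inequality for the positive semidefinite form `⟪x, y⟫ - ⟪C x, C y⟫`
  let c : PreInnerProductSpace.Core ℂ E :=
    { inner x y := inner ℂ x y - inner ℂ (C x) (C y)
      conj_inner_symm x y := by rw [map_sub, inner_conj_symm, inner_conj_symm]
      re_inner_nonneg x := by
        rw [map_sub, inner_self_eq_norm_sq, inner_self_eq_norm_sq, sub_nonneg]
        exact pow_le_pow_left₀ (norm_nonneg _) (hC x) 2
      add_left x y z := by
        rw [map_add, inner_add_left, inner_add_left]
        ring
      smul_left x y r := by
        rw [map_smul, inner_smul_left, inner_smul_left]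
        ring }
  have h : ‖inner ℂ x y - inner ℂ (C x) (C y)‖ * ‖inner ℂ y x - inner ℂ (C y) (C x)‖ ≤
      RCLike.re (inner ℂ x x - inner ℂ (C x) (C x)) *
        RCLike.re (inner ℂ y y - inner ℂ (C y) (C y)) :=
    @InnerProductSpace.Core.inner_mul_inner_self_le ℂ E _ _ _ c x y
  have hsymm : ‖inner ℂ y x - inner ℂ (C y) (C x)‖ = ‖inner ℂ x y - inner ℂ (C x) (C y)‖ := by
    rw [← inner_conj_symm y x, ← inner_conj_symm (C y) (C x), ← map_sub, RCLike.norm_conj]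
  rw [hsymm, ← sq, map_sub, map_sub, inner_self_eq_norm_sq, inner_self_eq_norm_sq,
    inner_self_eq_norm_sq, inner_self_eq_norm_sq] at h
  refine h.trans (mul_le_mul_of_nonneg_left (sub_le_self _ (sq_nonneg _)) (sub_nonneg.2 ?_))
  exact pow_le_pow_left₀ (norm_nonneg _) (hC x) 2

theorem tendsto_of_tendsto_inner_one {l : Filter α} {y : α → H} {e : H} (hy : ∀ k, ‖y k‖ ≤ 1)
    (he : ‖e‖ = 1) (h : Tendsto (fun k ↦ inner ℂ e (y k)) l (𝓝 1)) : Tendsto y l (𝓝 e) := by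
  have hre : Tendsto (fun k ↦ √(2 - 2 * (inner ℂ e (y k)).re)) l (𝓝 0) := by
    simpa using ((((Complex.continuous_re.tendsto 1).comp h).const_mul 2).const_sub 2).sqrt
  rw [tendsto_iff_norm_sub_tendsto_zero]
  refine squeeze_zero (fun _ ↦ norm_nonneg _) (fun k ↦ Real.le_sqrt_of_sq_le ?_) hre
  have := pow_le_one₀ (n := 2) (norm_nonneg _) (hy k)
  rw [norm_sub_rev, norm_sub_sq (𝕜 := ℂ), he]
  change _ - 2 * (inner ℂ e (y k)).re + _ ≤ _
  linarith

theorem tendsto_inner_of_contraction {l : Filter α} (C : E →ₗ[ℂ] H) (hC : ∀ x, ‖C x‖ ≤ ‖x‖)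
    {u : α → E} (hu : ∀ k, ‖u k‖ ≤ 1) {e : H} (he : ‖e‖ = 1)
    (h : Tendsto (fun k ↦ C (u k)) l (𝓝 e)) (x : E) :
    Tendsto (fun k ↦ inner ℂ (u k) x) l (𝓝 (inner ℂ e (C x))) := by
  have hsqrt : Tendsto (fun k ↦ √((1 - ‖C (u k)‖ ^ 2) * ‖x‖ ^ 2)) l (𝓝 0) := by
    have := (((h.norm.pow 2).const_sub 1).mul_const (‖x‖ ^ 2)).sqrt
    rwa [he, one_pow, sub_self, zero_mul, Real.sqrt_zero] at this
  have hdiff : Tendsto (fun k ↦ inner ℂ (u k) x - inner ℂ (C (u k)) (C x)) l (𝓝 0) := by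
    refine squeeze_zero_norm (fun k ↦ Real.le_sqrt_of_sq_le ?_) hsqrt
    refine (norm_inner_sub_inner_sq_le C hC (u k) x).trans ?_
    have := pow_le_one₀ (n := 2) (norm_nonneg _) (hu k)
    gcongr
  simpa using hdiff.add (h.inner (tendsto_const_nhds (x := C x)))

theorem tendsto_zero_of_orthonormal {f : ι → E} (hf : Orthonormal ℂ f) (l : StrongDual ℂ E) :
    Tendsto (fun n ↦ l (f n)) cofinite (𝓝 0) := by
  let i := UniformSpace.Completion.toComplₗᵢ (𝕜 := ℂ) (E := E)
  obtain ⟨y, hy⟩ := (InnerProductSpace.toDual ℂ (UniformSpace.Completion E)).surjective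
    (l.extend i.toContinuousLinearMap)
  have hl (x : E) : l x = inner ℂ y (i x) := by
    rw [← InnerProductSpace.toDual_apply_apply, hy]
    exact (ContinuousLinearMap.extend_eq l UniformSpace.Completion.denseRange_coe
      (UniformSpace.Completion.isUniformInducing_coe E) x).symm
  have h := ((hf.comp_linearIsometry i).inner_products_summable (x := y)).tendsto_cofinite_zero
  refine squeeze_zero_norm (a := fun n ↦ √(‖inner ℂ (i (f n)) y‖ ^ 2)) (fun n ↦ ?_)
    (by simpa using h.sqrt)
  rw [Real.sqrt_sq (norm_nonneg _), hl, norm_inner_symm]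

theorem exists_dual_eq_infDist (S : Submodule ℂ E) (x : E) :
    ∃ l : StrongDual ℂ E, (∀ y, ‖l y‖ ≤ ‖y‖) ∧ (∀ y ∈ S, l y = 0) ∧
      l x = Metric.infDist x (S : Set E) := by
  obtain ⟨g, hg, hgx⟩ := exists_dual_vector'' ℂ (Submodule.Quotient.mk x : E ⧸ S)
  refine ⟨g ∘L S.mkQL, fun y ↦ ?_, fun y hy ↦ ?_, ?_⟩
  · exact (g.le_of_opNorm_le_of_le hg (Submodule.Quotient.norm_mk_le S y)).trans_eq (one_mul _)
  · simp [(Submodule.Quotient.mk_eq_zero S).2 hy]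
  · exact hgx.trans (congrArg _ (QuotientAddGroup.norm_mk (S := S.toAddSubgroup) x))

end Contraction

/-! ### The spectral factor -/

section TriArray

variable {E : Type*} [NormedAddCommGroup E] [InnerProductSpace ℂ E] {v : Module.Basis ℕ ℂ E}

section

variable {F : ℕ → Type} [∀ k, NormedAddCommGroup (F k)] [∀ k, InnerProductSpace ℂ (F k)]

namespace TriArray

/-- The array `T` as an operator from a space with basis `v`: the linear map which sends the
basis vectors to the columns. -/
noncomputable def toMap (T : TriArray F) (v : Module.Basis ℕ ℂ E) : E →ₗ[ℂ] lp F 2 :=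
  v.constr ℂ T.col

theorem toMap_basis (T : TriArray F) (v : Module.Basis ℕ ℂ E) (j : ℕ) :
    T.toMap v (v j) = T.col j :=
  v.constr_basis ℂ _ j

theorem toKernel_eq_gram (T : TriArray F) (v : Module.Basis ℕ ℂ E) :
    T.toKernel = Matrix.gram ℂ (T.toMap v ∘ v) := by
  ext i j
  rw [toKernel, Matrix.gram_apply, Function.comp_apply, Function.comp_apply, toMap_basis,
    toMap_basis]

theorem posSemidef_gram_sub_toKernel_iff (T : TriArray F) :
    (Matrix.gram ℂ v - T.toKernel).PosSemidef ↔ ∀ x, ‖T.toMap v x‖ ≤ ‖x‖ := by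
  rw [T.toKernel_eq_gram v]
  exact posSemidef_gram_sub_gram_iff v LinearMap.id (T.toMap v)

theorem map_span_image_basis (T : TriArray F) (v : Module.Basis ℕ ℂ E) (s : Set ℕ) :
    (Submodule.span ℂ (v '' s)).map (T.toMap v) = Submodule.span ℂ (T.col '' s) := by
  rw [Submodule.map_span, Set.image_image]
  simp only [toMap_basis]

theorem IsOuter.infDist_col_le {T : TriArray F} (hT : T.IsOuter) (m : ℕ) :
    Metric.infDist (T.col m) (Submodule.span ℂ (T.col '' Set.Ioi m) : Set (lp F 2)) ≤
      ‖T.entry m m‖ := by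
  have hmem : T.col m - lp.single 2 m (T.entry m m) ∈
      (Submodule.span ℂ (T.col '' Set.Ioi m)).topologicalClosure := by
    refine hT (m + 1) _ fun i hi ↦ ?_
    rw [lp.coeFn_sub, Pi.sub_apply]
    rcases (Nat.lt_succ_iff.1 hi).eq_or_lt with rfl | hlt
    · rw [lp.single_apply_self]
      exact sub_self _
    · rw [lp.single_apply_ne _ _ _ hlt.ne, sub_zero]
      exact T.lower i m hlt
  rw [← Metric.infDist_closure]
  refine (Metric.infDist_le_dist_of_mem hmem).trans_eq ?_
  rw [dist_eq_norm, sub_sub_cancel, lp.norm_single two_pos]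

end TriArray

end

/-- The Hilbert spaces of an array with values in `ℂ` whose only non-zero row is the `m`-th. -/
def rowSpace (m k : ℕ) : Submodule ℂ ℂ := if k = m then ⊤ else ⊥

/-- The scalar `c` as an element of the space `rowSpace m m`. -/
def rowScalar (m : ℕ) : ℂ →ₗ[ℂ] rowSpace m m :=
  LinearMap.codRestrict _ LinearMap.id fun _ ↦ by simp [rowSpace]

/-- The array with `m`-th row `a` and all other rows zero. -/
noncomputable def rowArray (m : ℕ) (a : ℕ → ℂ) (ha : ∀ j, m < j → a j = 0) :
    TriArray fun k ↦ rowSpace m k where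
  entry k j := (lp.single 2 m (rowScalar m (a j)) : lp (fun k ↦ rowSpace m k) 2) k
  lower k j h := by
    rcases eq_or_ne k m with rfl | hk
    · rw [ha j h, map_zero, lp.single_zero]
      rfl
    · rw [lp.single_apply_ne _ _ _ hk]
  memlp j := lp.memℓp _

theorem rowArray_isOuter {m : ℕ} {a : ℕ → ℂ} (ha : ∀ j, m < j → a j = 0) (hm : a m ≠ 0) :
    (rowArray m a ha).IsOuter := by
  intro k x hx
  have hsingle : x = ((x m : ℂ) / a m) • (rowArray m a ha).col m := by
    refine lp.ext (funext fun i ↦ Subtype.ext ?_)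
    rcases eq_or_ne i m with rfl | hi
    · have : ((rowArray i a ha).col i i : ℂ) = a i :=
        congrArg Subtype.val (lp.single_apply_self (E := fun k ↦ rowSpace i k) 2 i _)
      rw [lp.coeFn_smul, Pi.smul_apply, Submodule.coe_smul, this, smul_eq_mul, div_mul_cancel₀ _ hm]
    · have hbot (y : rowSpace m i) : (y : ℂ) = 0 := by
        simpa [rowSpace, hi] using y.2
      rw [hbot, hbot]
  apply Submodule.le_topologicalClosure
  rcases lt_or_ge m k with h | h
  · rw [hsingle, hx m h]
    simp
  · rw [hsingle]
    exact Submodule.smul_mem _ _ (Submodule.subset_span ⟨m, h, rfl⟩)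

theorem norm_toMap_rowArray {m : ℕ} (l : E →ₗ[ℂ] ℂ) (hl : ∀ j, m < j → l (v j) = 0) (x : E) :
    ‖(rowArray m (fun j ↦ l (v j)) hl).toMap v x‖ = ‖l x‖ := by
  have h : (rowArray m (fun j ↦ l (v j)) hl).toMap v =
      lp.lsingle (E := fun k ↦ rowSpace m k) 2 m ∘ₗ rowScalar m ∘ₗ l :=
    v.ext fun j ↦ TriArray.toMap_basis _ v j
  rw [h]
  exact lp.norm_single (E := fun k ↦ rowSpace m k) two_pos m (rowScalar m (l x))

end TriArray

namespace IsSpectralFactor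

variable {E : Type*} [NormedAddCommGroup E] [InnerProductSpace ℂ E] {v : Module.Basis ℕ ℂ E}
  {Θ : Matrix ℕ ℕ ℂ}

theorem lower {K : Matrix ℕ ℕ ℂ} (hΘ : IsSpectralFactor K Θ) {m n : ℕ} (h : m < n) :
    Θ m n = 0 := by
  obtain ⟨F, T, hTΘ, -⟩ := hΘ
  rw [hTΘ, T.lower m n h, Submodule.coe_zero]

theorem exists_contraction (hΘ : IsSpectralFactor (Matrix.gram ℂ v) Θ) :
    ∃ C : E →ₗ[ℂ] lp (fun _ : ℕ ↦ ℂ) 2, (∀ x, ‖C x‖ ≤ ‖x‖) ∧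
      ∀ x i, C x i = v.constr ℂ (Θ i) x := by
  obtain ⟨F, T, hTΘ, -, -, hT, -⟩ := hΘ
  have hcoe (x : E) (i : ℕ) : (T.toMap v x i : ℂ) = v.constr ℂ (Θ i) x := by
    let row : E →ₗ[ℂ] ℂ := (F i).subtype ∘ₗ lp.evalₗ _ 2 i ∘ₗ T.toMap v
    refine LinearMap.congr_fun (f := row) (v.ext fun j ↦ ?_) x
    rw [v.constr_basis, hTΘ]
    exact congrArg (fun y : lp (fun k ↦ F k) 2 ↦ (y i : ℂ)) (T.toMap_basis v j)
  let C : E →ₗ[ℂ] lp (fun _ : ℕ ↦ ℂ) 2 :=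
    { toFun x := ⟨fun i ↦ (T.toMap v x i : ℂ), (lp.memℓp (T.toMap v x)).mono' fun _ ↦ le_rfl⟩
      map_add' x y := lp.ext (funext fun i ↦ by simp only [map_add]; rfl)
      map_smul' c x := lp.ext (funext fun i ↦ by simp only [map_smul]; rfl) }
  refine ⟨C, fun x ↦ ?_, hcoe⟩
  exact (lp.norm_mono (x := C x) (y := T.toMap v x) two_ne_zero fun _ ↦ le_rfl).trans
    (T.posSemidef_gram_sub_toKernel_iff.1 hT x)

theorem infDist_le_diag (hΘ : IsSpectralFactor (Matrix.gram ℂ v) Θ) (m : ℕ) :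
    Metric.infDist (v m) (Submodule.span ℂ (v '' Set.Ioi m) : Set E) ≤ ‖Θ m m‖ := by
  obtain ⟨F, T, hTΘ, -, hO, -, hmax⟩ := hΘ
  obtain ⟨l, hl, hlS, hlm⟩ := exists_dual_eq_infDist (Submodule.span ℂ (v '' Set.Ioi m)) (v m)
  rcases eq_or_ne (l (v m)) 0 with h0 | h0
  · exact (Complex.ofReal_eq_zero.1 (hlm.symm.trans h0)).trans_le (norm_nonneg _)
  have hl0 (j : ℕ) (hj : m < j) : l (v j) = 0 := hlS _ (Submodule.subset_span ⟨j, hj, rfl⟩)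
  have hle (x : E) : ‖l x‖ ≤ ‖T.toMap v x‖ := by
    have hrow := norm_toMap_rowArray (v := v) l hl0
    have h := hmax (fun k ↦ rowSpace m k) (rowArray m _ hl0) (rowArray_isOuter hl0 h0)
      ((TriArray.posSemidef_gram_sub_toKernel_iff _).2 fun x ↦ (hrow x).trans_le (hl x))
    rw [T.toKernel_eq_gram v, TriArray.toKernel_eq_gram _ v, posSemidef_gram_sub_gram_iff] at h
    exact (hrow x).symm.trans_le (h x)
  rw [hTΘ]
  refine le_trans ?_ (hO.infDist_col_le m)
  refine (Metric.le_infDist ⟨0, Submodule.zero_mem _⟩).2 fun y hy ↦ ?_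
  rw [SetLike.mem_coe, ← T.map_span_image_basis v] at hy
  obtain ⟨x, hx, rfl⟩ := hy
  have := hle (v m - x)
  rwa [map_sub, hlS x hx, sub_zero, hlm, Complex.norm_real,
    Real.norm_of_nonneg Metric.infDist_nonneg, map_sub, T.toMap_basis, ← dist_eq_norm] at this

theorem diag_le_infDist (hΘ : IsSpectralFactor (Matrix.gram ℂ v) Θ) (m : ℕ) :
    ‖Θ m m‖ ≤ Metric.infDist (v m) (Submodule.span ℂ (v '' Set.Ioi m) : Set E) := by
  obtain ⟨C, hC, hCΘ⟩ := hΘ.exists_contraction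
  refine (Metric.le_infDist ⟨0, Submodule.zero_mem _⟩).2 fun y hy ↦ ?_
  have hy0 : v.constr ℂ (Θ m) y = 0 := by
    have hker : Submodule.span ℂ (v '' Set.Ioi m) ≤ (v.constr ℂ (Θ m)).ker :=
      Submodule.span_le.2 (by
        rintro _ ⟨j, hj, rfl⟩
        exact (v.constr_basis ℂ _ j).trans (hΘ.lower hj))
    exact hker hy
  rw [dist_eq_norm]
  calc ‖Θ m m‖ = ‖C (v m - y) m‖ := by
        rw [hCΘ, map_sub, hy0, sub_zero, v.constr_basis]
    _ ≤ ‖C (v m - y)‖ := lp.norm_apply_le_norm (by norm_num) _ _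
    _ ≤ ‖v m - y‖ := hC _

theorem diag_eq_infDist (hΘ : IsSpectralFactor (Matrix.gram ℂ v) Θ) (m : ℕ) :
    Θ m m = Metric.infDist (v m) (Submodule.span ℂ (v '' Set.Ioi m) : Set E) := by
  have h0 : 0 ≤ Θ m m := by
    obtain ⟨F, T, -, h0, -⟩ := hΘ
    exact h0 m
  rw [Complex.eq_coe_norm_of_nonneg h0, (hΘ.diag_le_infDist m).antisymm (hΘ.infDist_le_diag m)]

end IsSpectralFactor

section Limits

variable {α ι E : Type*} [NormedAddCommGroup E] [InnerProductSpace ℂ E] {l : Filter α}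

theorem IsUnitComponent.le_norm_sub {v : Module.Basis ι ℂ E} {s : Set ι} {p : ι} {x y : E}
    (hx : IsUnitComponent v s p x) (hy : ∀ i ∉ s, v.repr y i = 0) :
    ‖v.repr x p‖⁻¹ ≤ ‖v p - y‖ := by
  have hyx : inner ℂ y x = 0 := by
    rw [inner_eq_star_repr_mul v (p := p), hy p hx.notMem, star_zero, zero_mul]
    exact fun i _ ↦ or_iff_not_imp_right.2 fun h ↦ hy i fun his ↦ h (hx.inner_eq_zero i his)
  calc ‖v.repr x p‖⁻¹ = ‖inner ℂ (v p) x‖ := by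
        rw [eq_inv_of_mul_eq_one_right hx.repr_mul_inner, norm_inv]
    _ = ‖inner ℂ (v p - y) x‖ := by rw [inner_sub_left, hyx, sub_zero]
    _ ≤ ‖v p - y‖ * ‖x‖ := norm_inner_le_norm _ _
    _ = ‖v p - y‖ := by rw [hx.norm_eq, mul_one]

theorem IsUnitComponent.infDist_le {v : Module.Basis ι ℂ E} {s t : Set ι} {p : ι} {x : E}
    (hx : IsUnitComponent v s p x) (hst : s ⊆ t) :
    Metric.infDist (v p) (Submodule.span ℂ (v '' t) : Set E) ≤ ‖v.repr x p‖⁻¹ := by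
  have hc : v.repr x p ≠ 0 := hx.repr_pos.ne'
  refine (Metric.infDist_le_dist_of_mem (y := v p - (v.repr x p)⁻¹ • x) ?_).trans_eq ?_
  · rw [SetLike.mem_coe, v.mem_span_image]
    intro i hi
    by_contra hit
    refine Finsupp.mem_support_iff.1 hi ?_
    rcases eq_or_ne i p with rfl | hip
    · simp [hc]
    · simp [hip, hx.repr_eq_zero i (fun h ↦ hit (hst h)) hip]
  · rw [dist_eq_norm, sub_sub_cancel, norm_smul, hx.norm_eq, mul_one, norm_inv]

theorem IsUnitComponent.tendsto_infDist {v : Module.Basis ι ℂ E} {s : α → Set ι} {t : Set ι}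
    {p : ι} {u : α → E} (hu : ∀ k, IsUnitComponent v (s k) p (u k)) (hst : ∀ k, s k ⊆ t)
    (hs : ∀ i ∈ t, ∀ᶠ k in l, i ∈ s k) :
    Tendsto (fun k ↦ ‖v.repr (u k) p‖⁻¹) l
      (𝓝 (Metric.infDist (v p) (Submodule.span ℂ (v '' t) : Set E))) := by
  refine tendsto_order.2 ⟨fun a ha ↦ .of_forall fun k ↦ ha.trans_le ((hu k).infDist_le (hst k)),
    fun a ha ↦ ?_⟩
  obtain ⟨y, hy, hya⟩ := (Metric.infDist_lt_iff ⟨0, Submodule.zero_mem _⟩).1 ha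
  have hys : ∀ᶠ k in l, ∀ i ∈ (v.repr y).support, i ∈ s k :=
    (eventually_all_finset _).2 fun i hi ↦ hs i ((v.mem_span_image).1 hy hi)
  filter_upwards [hys] with k hk
  refine ((hu k).le_norm_sub fun i hi ↦ ?_).trans_lt (by rwa [← dist_eq_norm])
  exact Finsupp.notMem_support_iff.1 fun h ↦ hi (hk i h)

end Limits

namespace IsSpectralFactor

variable {α E : Type*} [NormedAddCommGroup E] [InnerProductSpace ℂ E] {v : Module.Basis ℕ ℂ E}
  {Θ : Matrix ℕ ℕ ℂ} {l : Filter α} {s : α → Set ℕ} {m : ℕ} {u : α → E}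

theorem constr_eq_sum (hΘ : IsSpectralFactor (Matrix.gram ℂ v) Θ) (m : ℕ) (x : E) :
    v.constr ℂ (Θ m) x = ∑ j ∈ Finset.range (m + 1), v.repr x j * Θ m j := by
  rw [v.constr_apply]
  refine Finset.sum_congr_of_eq_on_inter (fun j _ hj ↦ ?_) (fun j _ hj ↦ ?_) fun _ _ _ ↦ rfl
  · simp [hΘ.lower (show m < j by simpa using hj)]
  · rw [Finsupp.notMem_support_iff.1 hj, zero_mul]

theorem tendsto_constr_diag (hΘ : IsSpectralFactor (Matrix.gram ℂ v) Θ) (hpos : 0 < Θ m m)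
    (hu : ∀ k, IsUnitComponent v (s k) m (u k)) (hsm : ∀ k, s k ⊆ Set.Ioi m)
    (hs : ∀ i, m < i → ∀ᶠ k in l, i ∈ s k) :
    Tendsto (fun k ↦ v.constr ℂ (Θ m) (u k)) l (𝓝 1) := by
  have hlim := ((Complex.continuous_ofReal.tendsto _).comp
    (IsUnitComponent.tendsto_infDist hu hsm hs)).inv₀ (hΘ.diag_eq_infDist m ▸ hpos.ne')
  have h := hlim.mul_const (Θ m m)
  rw [hΘ.diag_eq_infDist, inv_mul_cancel₀ (hΘ.diag_eq_infDist m ▸ hpos.ne')] at h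
  refine h.congr fun k ↦ ?_
  rw [hΘ.constr_eq_sum, Finset.sum_range_succ, Finset.sum_eq_zero, zero_add,
    Complex.eq_coe_norm_of_nonneg (hu k).repr_pos.le, hΘ.diag_eq_infDist, Function.comp_apply,
    Complex.ofReal_inv, inv_inv]
  intro j hj
  have hjm := Finset.mem_range.1 hj
  rw [(hu k).repr_eq_zero j (fun h ↦ (hsm k h).not_gt hjm) hjm.ne, zero_mul]

/-- Along unit components of `v m` with respect to sets exhausting `{i | m < i}` the contraction
converges to the `m`-th coordinate vector, because its `m`-th coordinate tends to `1`. -/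
theorem tendsto_inner_and_constr (hΘ : IsSpectralFactor (Matrix.gram ℂ v) Θ) (hpos : 0 < Θ m m)
    (hu : ∀ k, IsUnitComponent v (s k) m (u k)) (hsm : ∀ k, s k ⊆ Set.Ioi m)
    (hs : ∀ i, m < i → ∀ᶠ k in l, i ∈ s k) :
    (∀ j, Tendsto (fun k ↦ inner ℂ (u k) (v j)) l (𝓝 (Θ m j))) ∧
      ∀ i, Tendsto (fun k ↦ v.constr ℂ (Θ i) (u k)) l (𝓝 (if i = m then 1 else 0)) := by
  obtain ⟨C, hC, hCΘ⟩ := hΘ.exists_contraction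
  let e : lp (fun _ : ℕ ↦ ℂ) 2 := lp.single 2 m 1
  have he : ‖e‖ = 1 := by rw [lp.norm_single two_pos, norm_one]
  have hinner (y : lp (fun _ : ℕ ↦ ℂ) 2) : inner ℂ e y = y m := by
    rw [lp.inner_single_left]
    simp
  have hu1 (k) : ‖u k‖ ≤ 1 := (hu k).norm_eq.le
  have hlim : Tendsto (fun k ↦ C (u k)) l (𝓝 e) := by
    refine tendsto_of_tendsto_inner_one (fun k ↦ (hC _).trans (hu1 k)) he ?_
    simpa only [hinner, hCΘ] using hΘ.tendsto_constr_diag hpos hu hsm hs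
  refine ⟨fun j ↦ ?_, fun i ↦ ?_⟩
  · simpa only [hinner, hCΘ, v.constr_basis] using
      tendsto_inner_of_contraction C hC hu1 he hlim (v j)
  · have hei : e i = if i = m then 1 else 0 := by
      rw [lp.single_apply, Pi.single_apply]
    rw [← hei]
    exact (((lp.evalCLM ℂ (fun _ : ℕ ↦ ℂ) 2 i).continuous.tendsto e).comp hlim).congr
      fun k ↦ hCΘ (u k) i

theorem tendsto_repr_of_orthonormal (hΘ : IsSpectralFactor (Matrix.gram ℂ v) Θ)
    (hpos : ∀ m, 0 < Θ m m) {ι : Type*} {f : ι → E} (hf : Orthonormal ℂ f) (m : ℕ) :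
    Tendsto (fun n ↦ v.repr (f n) m) cofinite (𝓝 0) := by
  obtain ⟨C, hC, hCΘ⟩ := hΘ.exists_contraction
  have hrow (m : ℕ) : Tendsto (fun n ↦ v.constr ℂ (Θ m) (f n)) cofinite (𝓝 0) := by
    refine tendsto_zero_of_orthonormal hf ((v.constr ℂ (Θ m)).mkContinuous 1 fun x ↦ ?_)
    rw [one_mul, ← hCΘ]
    exact (lp.norm_apply_le_norm two_ne_zero _ _).trans (hC x)
  induction m using Nat.strong_induction_on with
  | _ m ih =>
    have h : Tendsto (fun n ↦ (v.constr ℂ (Θ m) (f n) -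
        ∑ j ∈ Finset.range m, v.repr (f n) j * Θ m j) / Θ m m) cofinite
        (𝓝 ((0 - ∑ j ∈ Finset.range m, 0 * Θ m j) / Θ m m)) :=
      ((hrow m).sub (tendsto_finsetSum _ fun j hj ↦
        (ih j (Finset.mem_range.1 hj)).mul_const _)).div_const _
    simp only [zero_mul, Finset.sum_const_zero, sub_zero, zero_div] at h
    refine h.congr fun n ↦ ?_
    rw [hΘ.constr_eq_sum, Finset.sum_range_succ, add_sub_cancel_left,
      mul_div_cancel_right₀ _ (hpos m).ne']

end IsSpectralFactor

/-! ### Words and monomials -/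

section Words

variable {N : ℕ} [NeZero N]

/-- The enumeration of the words in the order `≺`. -/
def wordEquiv (N : ℕ) [NeZero N] : Word N ≃ ℕ where
  toFun := wordIndex
  invFun := wordAt N
  left_inv := wordAt_wordIndex
  right_inv := wordIndex_wordAt

theorem wordIndex_injective : Function.Injective (wordIndex (N := N)) := (wordEquiv N).injective

theorem wordIndex_surjective : Function.Surjective (wordIndex (N := N)) := (wordEquiv N).surjective

theorem wordIndex_one {N : ℕ} : wordIndex (1 : Word N) = 0 := rfl

theorem shortlex_of_wordIndex_lt {a b : Word N} (h : wordIndex a < wordIndex b) :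
    List.Shortlex (· < ·) a.toList b.toList := by
  simpa only [wordAt_wordIndex] using shortlex_wordAt (N := N) h

theorem wordIndex_lt_iff_shortlex {a b : Word N} :
    wordIndex a < wordIndex b ↔ List.Shortlex (· < ·) a.toList b.toList := by
  refine ⟨shortlex_of_wordIndex_lt, fun h ↦ ?_⟩
  rcases lt_trichotomy (wordIndex a) (wordIndex b) with hlt | heq | hgt
  · exact hlt
  · exact absurd h (wordIndex_injective heq ▸ Std.Irrefl.irrefl (r := List.Shortlex _) _)
  · exact absurd h (Std.Asymm.asymm (r := List.Shortlex _) _ _ (shortlex_of_wordIndex_lt hgt))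

theorem wordIndex_of_mul_lt_iff (k : Fin N) {a b : Word N} :
    wordIndex (FreeMonoid.of k * a) < wordIndex (FreeMonoid.of k * b) ↔
      wordIndex a < wordIndex b := by
  simp only [wordIndex_lt_iff_shortlex, FreeMonoid.toList_of_mul, List.shortlex_cons_iff]

theorem wordIndex_of_mul_pos (k : Fin N) (w : Word N) : 0 < wordIndex (FreeMonoid.of k * w) := by
  rw [← wordIndex_one (N := N), wordIndex_lt_iff_shortlex]
  exact List.Shortlex.of_length_lt (by simp)

end Words

section Monomials

variable {N : ℕ}

theorem mono_one : mono (1 : Word N) = 1 := rfl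

theorem mono_of_mul (k : Fin N) (w : Word N) : mono (FreeMonoid.of k * w) = var k * mono w := by
  simp only [mono, var, MonoidAlgebra.single_mul_single, mul_one]

theorem coeff_var_mul (k l : Fin N) (P : PolyN N) (w : Word N) :
    (var k * P).coeff (FreeMonoid.of l * w) = if k = l then P.coeff w else 0 := by
  split_ifs with hkl
  · rw [hkl, var, mono, MonoidAlgebra.coeff_single_mul_eq_mul_coeff w fun _ _ ↦ mul_right_inj _,
      one_mul]
  · refine MonoidAlgebra.coeff_single_mul_of_forall_mul_ne _ _ fun u hu ↦ hkl ?_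
    exact (List.cons.inj (congrArg FreeMonoid.toList hu)).1

theorem coeff_var_mul_one (k : Fin N) (P : PolyN N) : (var k * P).coeff 1 = 0 :=
  MonoidAlgebra.coeff_single_mul_of_forall_mul_ne _ _ fun _ hu ↦
    List.cons_ne_nil _ _ (congrArg FreeMonoid.toList hu)

/-- The basis of the monomials, in the order of their words. -/
noncomputable def monoBasis (N : ℕ) [NeZero N] : Module.Basis ℕ ℂ (PolyN N) :=
  (Module.Basis.ofRepr (MonoidAlgebra.coeffLinearEquiv ℂ)).reindex (wordEquiv N)

theorem monoBasis_wordIndex [NeZero N] (w : Word N) : monoBasis N (wordIndex w) = mono w :=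
  (Module.Basis.reindex_apply ..).trans (congrArg mono (wordAt_wordIndex w))

theorem monoBasis_repr_wordIndex [NeZero N] (P : PolyN N) (w : Word N) :
    (monoBasis N).repr P (wordIndex w) = P.coeff w :=
  (Module.Basis.repr_reindex_apply ..).trans (congrArg P.coeff (wordAt_wordIndex w))

end Monomials

/-! ### The quotient algebra and the form -/

section Involution

variable {N : ℕ}

theorem invol_single (w : FreeMonoid (Fin N ⊕ Fin N)) (c : ℂ) :
    invol (MonoidAlgebra.single w c) = MonoidAlgebra.single (invWord w) (star c) := by
  rw [invol, MonoidAlgebra.coeff_single, Finsupp.sum_single_index (by simp)]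

theorem invol_add (P Q : Poly2N N) : invol (P + Q) = invol P + invol Q :=
  Finsupp.sum_add_index' (by simp) fun _ _ _ ↦ by rw [star_add, MonoidAlgebra.single_add]

theorem invol_zero : invol (0 : Poly2N N) = 0 := Finsupp.sum_zero_index

theorem invol_smul (c : ℂ) (P : Poly2N N) : invol (c • P) = star c • invol P := by
  induction P using MonoidAlgebra.induction_linear with
  | zero => rw [smul_zero, invol_zero, smul_zero]
  | add P Q hP hQ => rw [smul_add, invol_add, invol_add, hP, hQ, smul_add]
  | single w a => simp only [MonoidAlgebra.smul_single', invol_single, star_mul']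

theorem invWord_mul (u w : FreeMonoid (Fin N ⊕ Fin N)) :
    invWord (u * w) = invWord w * invWord u := by
  simp [invWord, FreeMonoid.toList_mul, FreeMonoid.ofList_append]

theorem invol_mul (P Q : Poly2N N) : invol (P * Q) = invol Q * invol P := by
  induction P using MonoidAlgebra.induction_linear with
  | zero => rw [zero_mul, invol_zero, mul_zero]
  | add P P' hP hP' => rw [add_mul, invol_add, invol_add, hP, hP', mul_add]
  | single u a =>
    induction Q using MonoidAlgebra.induction_linear with
    | zero => rw [mul_zero, invol_zero, zero_mul]
    | add Q Q' hQ hQ' => rw [mul_add, invol_add, invol_add, hQ, hQ', add_mul]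
    | single w b =>
      simp only [MonoidAlgebra.single_mul_single, invol_single, invWord_mul, star_mul]

theorem invol_one : invol (1 : Poly2N N) = 1 :=
  (invol_single 1 1).trans (congrArg _ (star_one ℂ))

theorem incl_var (k : Fin N) :
    incl (var k) = MonoidAlgebra.single (FreeMonoid.of (Sum.inl k)) 1 := by
  simp [incl, var, mono]

theorem invol_incl_var (k : Fin N) :
    invol (incl (var k)) = MonoidAlgebra.single (FreeMonoid.of (Sum.inr k)) 1 := by
  rw [incl_var, invol_single, star_one]
  rfl

end Involution

section Fock

variable {N : ℕ}

/-- The annihilation operator of the letter `k` on the full Fock space: it removes the first letter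
of the words starting with `k` and kills the other ones. -/
noncomputable def annihilate (k : Fin N) : PolyN N →ₗ[ℂ] PolyN N :=
  (MonoidAlgebra.coeffLinearEquiv ℂ).symm.toLinearMap ∘ₗ
    Finsupp.lcomapDomain (FreeMonoid.of k * ·) (mul_right_injective _) ∘ₗ
      (MonoidAlgebra.coeffLinearEquiv ℂ).toLinearMap

theorem annihilate_var_mul (k l : Fin N) (P : PolyN N) :
    annihilate k (var l * P) = if l = k then P else 0 := by
  ext w
  refine (coeff_var_mul l k P w).trans ?_
  split_ifs <;> rfl

/-- The representation of the polynomials in `2N` variables by the creation operators `X_k` and the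
annihilation operators `X_{N+k}` of the full Fock space. -/
noncomputable def fockRep (N : ℕ) : Poly2N N →ₐ[ℂ] Module.End ℂ (PolyN N) :=
  MonoidAlgebra.lift ℂ _ _ (FreeMonoid.lift
    (Sum.elim (fun k ↦ LinearMap.mulLeft ℂ (var k)) annihilate))

theorem fockRep_incl (P : PolyN N) : fockRep N (incl P) = LinearMap.mulLeft ℂ P := by
  suffices h : (fockRep N).comp incl = Algebra.lmul ℂ (PolyN N) from DFunLike.congr_fun h P
  refine MonoidAlgebra.algHom_ext' (FreeMonoid.hom_eq fun k ↦ ?_) (Subsingleton.elim _ _)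
  change fockRep N (incl (var k)) = LinearMap.mulLeft ℂ (var k)
  rw [incl_var, fockRep, MonoidAlgebra.lift_single, FreeMonoid.lift_eval_of, one_smul, Sum.elim_inl]

theorem fockRep_invol_incl_var (k : Fin N) : fockRep N (invol (incl (var k))) = annihilate k := by
  rw [invol_incl_var, fockRep, MonoidAlgebra.lift_single, FreeMonoid.lift_eval_of, one_smul,
    Sum.elim_inr]

theorem fockRep_eq_zero_of_mem_stationaryRel {P : Poly2N N} (hP : P ∈ stationaryRel N) :
    fockRep N P = 0 := by
  rcases hP with ⟨k, rfl⟩ | ⟨k, l, hkl, rfl⟩ <;> refine LinearMap.ext fun Q ↦ ?_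
  · simp [fockRep_incl, fockRep_invol_incl_var, annihilate_var_mul]
  · simp [fockRep_incl, fockRep_invol_incl_var, annihilate_var_mul, hkl.symm]

theorem eq_zero_of_proj_incl_eq_zero {P : PolyN N} (h : proj (stationaryRel N) (incl P) = 0) :
    P = 0 := by
  let fockRepQuot := RingQuot.liftAlgHom ℂ
    (s := fun P Q : Poly2N N ↦ P ∈ stationaryRel N ∧ Q = 0)
    ⟨fockRep N, fun P Q hPQ ↦ by
      rw [fockRep_eq_zero_of_mem_stationaryRel hPQ.1, hPQ.2, map_zero]⟩
  have hquot : fockRepQuot (proj (stationaryRel N) (incl P)) = fockRep N (incl P) :=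
    RingQuot.liftAlgHom_mkAlgHom_apply ..
  rw [h, map_zero, fockRep_incl] at hquot
  simpa using (DFunLike.congr_fun hquot 1).symm

end Fock

section Form

variable {N : ℕ} {A : Set (Poly2N N)} (φ : QuotAlg A →ₗ[ℂ] ℂ)

theorem form_add_left (P P' Q : PolyN N) : form φ (P + P') Q = form φ P Q + form φ P' Q := by
  simp only [form, map_add, mul_add]

theorem form_add_right (P Q Q' : PolyN N) : form φ P (Q + Q') = form φ P Q + form φ P Q' := by
  simp only [form, map_add, invol_add, add_mul]

theorem form_smul_left (c : ℂ) (P Q : PolyN N) : form φ (c • P) Q = c * form φ P Q := by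
  simp only [form, map_smul, mul_smul_comm, smul_eq_mul]

theorem form_smul_right (c : ℂ) (P Q : PolyN N) : form φ P (c • Q) = star c * form φ P Q := by
  simp only [form, map_smul, invol_smul, smul_mul_assoc, smul_eq_mul]

theorem form_one_one : form φ (1 : PolyN N) 1 = φ 1 := by
  rw [form, map_one, invol_one, mul_one, map_one]

theorem star_form {φ : QuotAlg A →ₗ[ℂ] ℂ} (h : ∀ P : PolyN N, 0 ≤ form φ P P) (P Q : PolyN N) :
    star (form φ P Q) = form φ Q P := by
  have him (P) : (form φ P P).im = 0 := (Complex.nonneg_iff.1 (h P)).2.symm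
  have hadd := him (P + Q)
  have hadd_I := him (P + Complex.I • Q)
  simp only [form_add_left, form_add_right, form_smul_left, form_smul_right, Complex.add_im,
    Complex.add_re, him, Complex.star_def, Complex.conj_I, Complex.mul_im, Complex.mul_re,
    Complex.I_re, Complex.I_im, Complex.neg_re, Complex.neg_im] at hadd hadd_I
  apply Complex.ext
  · rw [Complex.star_def, Complex.conj_re]
    linarith
  · rw [Complex.star_def, Complex.conj_im]
    linarith

theorem proj_eq_zero {P : Poly2N N} (h : P ∈ A) : proj A P = 0 := by
  have hrel := RingQuot.mkAlgHom_rel ℂ (s := fun P Q : Poly2N N ↦ P ∈ A ∧ Q = 0) ⟨h, rfl⟩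
  rwa [map_zero] at hrel

theorem proj_invol_incl_var_mul_incl_var (k l : Fin N) :
    proj (stationaryRel N) (invol (incl (var l)) * incl (var k)) = if k = l then 1 else 0 := by
  split_ifs with hkl
  · subst hkl
    have hrel := proj_eq_zero (A := stationaryRel N) (Or.inl ⟨k, rfl⟩)
    rwa [map_sub, map_one, sub_eq_zero, eq_comm] at hrel
  · exact proj_eq_zero (Or.inr ⟨l, k, Ne.symm hkl, rfl⟩)

theorem form_var_mul (φ : QuotAlg (stationaryRel N) →ₗ[ℂ] ℂ) (k l : Fin N) (P Q : PolyN N) :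
    form φ (var k * P) (var l * Q) = if k = l then form φ P Q else 0 := by
  have hmul : invol (incl (var l * Q)) * incl (var k * P) =
      invol (incl Q) * (invol (incl (var l)) * incl (var k)) * incl P := by
    simp only [map_mul, invol_mul, mul_assoc]
  rw [form, hmul, map_mul (proj _), map_mul (proj _), proj_invol_incl_var_mul_incl_var, form,
    map_mul (proj _)]
  split_ifs <;> simp

variable {φ : QuotAlg (stationaryRel N) →ₗ[ℂ] ℂ}

theorem StrictlyPositive.form_self_pos (hpos : StrictlyPositive φ) {P : PolyN N} (hP : P ≠ 0) :
    0 < form φ P P :=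
  hpos P fun h ↦ hP (eq_zero_of_proj_incl_eq_zero h)

theorem StrictlyPositive.form_self_nonneg (hpos : StrictlyPositive φ) (P : PolyN N) :
    0 ≤ form φ P P := by
  rcases eq_or_ne P 0 with rfl | hP
  · simp [form]
  · exact (hpos.form_self_pos hP).le

end Form

/-- The inner product space of the polynomials in `X_1, …, X_N` with `⟨Q, P⟩ = φ(𝒥(Q) P)`, a copy of
`PolyN N`. It is indexed by the proof of positivity so that its norm can be an instance. -/
def FormSpace {N : ℕ} {φ : QuotAlg (stationaryRel N) →ₗ[ℂ] ℂ} (_hpos : StrictlyPositive φ) : Type :=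
  PolyN N

namespace FormSpace

variable {N : ℕ} {φ : QuotAlg (stationaryRel N) →ₗ[ℂ] ℂ} (hpos : StrictlyPositive φ)

noncomputable instance : AddCommGroup (FormSpace hpos) := inferInstanceAs (AddCommGroup (PolyN N))

noncomputable instance : Module ℂ (FormSpace hpos) := inferInstanceAs (Module ℂ (PolyN N))

/-- A polynomial as an element of the inner product space of `φ`. -/
noncomputable def ofPoly : PolyN N ≃ₗ[ℂ] FormSpace hpos := LinearEquiv.refl ℂ (PolyN N)

/-- The inner product of the space of `φ`. -/
noncomputable abbrev innerCore : InnerProductSpace.Core ℂ (FormSpace hpos) where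
  inner P Q := form φ ((ofPoly hpos).symm Q) ((ofPoly hpos).symm P)
  conj_inner_symm _ _ := star_form hpos.form_self_nonneg _ _
  re_inner_nonneg _ := (Complex.nonneg_iff.1 (hpos.form_self_nonneg _)).1
  add_left _ _ _ := form_add_right φ ..
  smul_left _ _ _ := form_smul_right φ ..
  definite P hP := by
    by_contra h
    exact (hpos.form_self_pos h).ne' hP

noncomputable instance : NormedAddCommGroup (FormSpace hpos) :=
  (innerCore hpos).toNormedAddCommGroup

noncomputable instance : InnerProductSpace ℂ (FormSpace hpos) :=
  InnerProductSpace.ofCore (innerCore hpos).toCore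

theorem inner_ofPoly (P Q : PolyN N) : inner ℂ (ofPoly hpos P) (ofPoly hpos Q) = form φ Q P := rfl

theorem norm_sq_ofPoly (P : PolyN N) : ‖ofPoly hpos P‖ ^ 2 = (form φ P P).re :=
  (inner_self_eq_norm_sq (𝕜 := ℂ) (ofPoly hpos P)).symm

theorem norm_ofPoly_one (hunit : φ 1 = 1) : ‖ofPoly hpos 1‖ = 1 := by
  rw [← pow_eq_one_iff_of_nonneg (norm_nonneg _) two_ne_zero, norm_sq_ofPoly, form_one_one, hunit,
    Complex.one_re]

theorem norm_ofPoly_var_mul (k : Fin N) (P : PolyN N) :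
    ‖ofPoly hpos (var k * P)‖ = ‖ofPoly hpos P‖ := by
  rw [← pow_left_inj₀ (norm_nonneg _) (norm_nonneg _) two_ne_zero, norm_sq_ofPoly, norm_sq_ofPoly,
    form_var_mul, if_pos rfl]

variable [NeZero N]

/-- The basis of the monomials, in the order of their words. -/
noncomputable def basis : Module.Basis ℕ ℂ (FormSpace hpos) := (monoBasis N).map (ofPoly hpos)

theorem basis_wordIndex (w : Word N) : basis hpos (wordIndex w) = ofPoly hpos (mono w) := by
  rw [basis, Module.Basis.map_apply, monoBasis_wordIndex]

theorem basis_repr_wordIndex (P : PolyN N) (w : Word N) :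
    (basis hpos).repr (ofPoly hpos P) (wordIndex w) = P.coeff w :=
  monoBasis_repr_wordIndex P w

theorem kernel_eq_gram : kernel φ = Matrix.gram ℂ (basis hpos) := by
  ext m n
  obtain ⟨s, rfl⟩ := wordIndex_surjective (N := N) m
  obtain ⟨t, rfl⟩ := wordIndex_surjective (N := N) n
  rw [Matrix.gram_apply, basis_wordIndex, basis_wordIndex, inner_ofPoly, kernel, wordAt_wordIndex,
    wordAt_wordIndex]

end FormSpace

/-! ### Formal power series -/

section Series

variable {N : ℕ}

theorem mulSeries_one_apply (f g : Series N) : mulSeries f g 1 = f 1 * g 1 :=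
  Finset.sum_range_one _

theorem mulSeries_of_mul_apply (f g : Series N) (a : Fin N) (w : Word N) :
    mulSeries f g (FreeMonoid.of a * w) = f 1 * g (FreeMonoid.of a * w) +
      mulSeries (fun u ↦ f (FreeMonoid.of a * u)) g w := by
  rw [mulSeries, FreeMonoid.length_mul, FreeMonoid.length_of, add_comm 1 w.length,
    Finset.sum_range_succ', add_comm]
  rfl

theorem mulSeries_apply_eq_sum_add (f g : Series N) (w : Word N) :
    mulSeries f g w = ∑ i ∈ Finset.range w.length,
      f (FreeMonoid.ofList (w.toList.take i)) * g (FreeMonoid.ofList (w.toList.drop i)) +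
        f w * g 1 := by
  rw [mulSeries, Finset.sum_range_succ]
  congr 3
  · exact List.take_length
  · exact congrArg FreeMonoid.ofList List.drop_length

theorem add_mulSeries (f f' g : Series N) :
    mulSeries (f + f') g = mulSeries f g + mulSeries f' g := by
  ext w
  simp only [mulSeries, Pi.add_apply, add_mul, Finset.sum_add_distrib]

theorem smul_mulSeries (c : ℂ) (f g : Series N) : mulSeries (c • f) g = c • mulSeries f g := by
  ext w
  simp only [mulSeries, Pi.smul_apply, smul_eq_mul, mul_assoc, Finset.mul_sum]

theorem zero_mulSeries (g : Series N) : mulSeries 0 g = 0 := by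
  ext w
  simp [mulSeries]

theorem mulSeries_assoc (f g h : Series N) :
    mulSeries (mulSeries f g) h = mulSeries f (mulSeries g h) := by
  ext w
  induction w using FreeMonoid.inductionOn' generalizing f with
  | one => simp only [mulSeries_one_apply, mul_assoc]
  | of_mul a w ih =>
    have hshift : (fun u ↦ mulSeries f g (FreeMonoid.of a * u)) =
        f 1 • (fun u ↦ g (FreeMonoid.of a * u)) + mulSeries (fun u ↦ f (FreeMonoid.of a * u)) g :=
      funext fun u ↦ mulSeries_of_mul_apply f g a u
    rw [mulSeries_of_mul_apply, hshift, add_mulSeries, smul_mulSeries, Pi.add_apply, Pi.smul_apply,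
      ih, mulSeries_of_mul_apply f, mulSeries_of_mul_apply g, mulSeries_one_apply, smul_eq_mul]
    ring

theorem oneSeries_one : oneSeries N 1 = 1 := rfl

theorem oneSeries_of_mul (a : Fin N) (w : Word N) : oneSeries N (FreeMonoid.of a * w) = 0 :=
  if_neg (by simp)

theorem one_mulSeries (g : Series N) : mulSeries (oneSeries N) g = g := by
  ext w
  induction w using FreeMonoid.inductionOn' with
  | one => rw [mulSeries_one_apply, oneSeries_one, one_mul]
  | of_mul a w =>
    have hshift : (fun u ↦ oneSeries N (FreeMonoid.of a * u)) = 0 := funext (oneSeries_of_mul a)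
    rw [mulSeries_of_mul_apply, hshift, zero_mulSeries, Pi.zero_apply, oneSeries_one, one_mul,
      add_zero]

theorem mulSeries_one (f : Series N) : mulSeries f (oneSeries N) = f := by
  ext w
  induction w using FreeMonoid.inductionOn' generalizing f with
  | one => rw [mulSeries_one_apply, oneSeries_one, mul_one]
  | of_mul a w ih => rw [mulSeries_of_mul_apply, ih, oneSeries_of_mul, mul_zero, zero_add]

theorem toSeries_one : toSeries (1 : PolyN N) = oneSeries N := by
  classical
  ext w
  rw [oneSeries, toSeries, MonoidAlgebra.one_def, MonoidAlgebra.coeff_single, Finsupp.single_apply]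
  exact if_congr (by rw [FreeMonoid.length_eq_zero, eq_comm]) rfl rfl

theorem toSeries_add (P Q : PolyN N) : toSeries (P + Q) = toSeries P + toSeries Q := rfl

theorem toSeries_smul (c : ℂ) (P : PolyN N) : toSeries (c • P) = c • toSeries P := rfl

/-- The inverse of a series with nonzero constant coefficient, by recursion on the length of the
word. -/
noncomputable def seriesInv (f : Series N) (w : Word N) : ℂ :=
  (oneSeries N w - ∑ i : Fin w.length, seriesInv f (FreeMonoid.ofList (w.toList.take i)) *
    f (FreeMonoid.ofList (w.toList.drop i))) / f 1
termination_by w.length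
decreasing_by exact (List.length_take_le _ _).trans_lt i.2

theorem seriesInv_mulSeries {f : Series N} (hf : f 1 ≠ 0) :
    mulSeries (seriesInv f) f = oneSeries N := by
  ext w
  rw [mulSeries_apply_eq_sum_add, seriesInv, div_mul_cancel₀ _ hf, Finset.sum_range]
  exact add_sub_cancel _ _

theorem seriesInv_one_ne_zero {f : Series N} (hf : f 1 ≠ 0) : seriesInv f 1 ≠ 0 := by
  have hmul := congrFun (seriesInv_mulSeries hf) 1
  rw [mulSeries_one_apply, oneSeries_one] at hmul
  exact left_ne_zero_of_mul_eq_one hmul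

theorem isInverse_seriesInv {f : Series N} (hf : f 1 ≠ 0) : IsInverse f (seriesInv f) := by
  have hinv := seriesInv_mulSeries hf
  have hinv_inv := seriesInv_mulSeries (seriesInv_one_ne_zero hf)
  have hdouble : seriesInv (seriesInv f) = f := by
    rw [← mulSeries_one (seriesInv (seriesInv f)), ← hinv, ← mulSeries_assoc, hinv_inv,
      one_mulSeries]
  exact ⟨by rwa [hdouble] at hinv_inv, hinv⟩

theorem eq_seriesInv {f g : Series N} (hf : f 1 ≠ 0) (h : mulSeries f g = oneSeries N) :
    g = seriesInv f := by
  rw [← mulSeries_one (seriesInv f), ← h, ← mulSeries_assoc, seriesInv_mulSeries hf, one_mulSeries]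

theorem continuousAt_seriesInv {f : Series N} (hf : f 1 ≠ 0) : ContinuousAt seriesInv f := by
  have hcoeff (n : ℕ) (w : Word N) (hw : w.length = n) :
      ContinuousAt (fun g ↦ seriesInv g w) f := by
    induction n using Nat.strong_induction_on generalizing w with
    | _ n ih =>
      simp only [seriesInv.eq_1 _ w]
      refine .div (.sub continuousAt_const (tendsto_finsetSum _ fun i _ ↦ .mul ?_ ?_)) ?_ hf
      · exact ih _ (hw ▸ (List.length_take_le _ _).trans_lt i.2) _ rfl
      · exact (continuous_apply _).continuousAt
      · exact (continuous_apply _).continuousAt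
  exact continuousAt_pi.2 fun w ↦ hcoeff _ w rfl

theorem continuous_mulSeries (f : Series N) : Continuous (mulSeries f) :=
  continuous_pi fun _ ↦ by unfold mulSeries; fun_prop

theorem tendsto_of_isInverse_of_tendsto_mulSeries {ι : Type*} {l : Filter ι} {f ψ : ι → Series N}
    {θ : Series N} (hθ : θ 1 ≠ 0) (hf : ∀ i, f i 1 ≠ 0) (hψ : ∀ i, IsInverse (f i) (ψ i))
    (h : Tendsto (fun i ↦ mulSeries (f i) θ) l (𝓝 (oneSeries N))) : Tendsto ψ l (𝓝 θ) := by
  have hψ_eq (i : ι) : mulSeries θ (seriesInv (mulSeries (f i) θ)) = ψ i := by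
    have hi : mulSeries (f i) θ 1 ≠ 0 := by
      rw [mulSeries_one_apply]
      exact mul_ne_zero (hf i) hθ
    rw [← one_mulSeries (mulSeries θ _), ← (hψ i).2, mulSeries_assoc, ← mulSeries_assoc (f i),
      (isInverse_seriesInv hi).1, mulSeries_one]
  have hone : oneSeries N 1 ≠ 0 := one_ne_zero
  have hinv := (continuousAt_seriesInv hone).tendsto.comp h
  rw [← eq_seriesInv hone (one_mulSeries _)] at hinv
  have hmul := ((continuous_mulSeries θ).tendsto _).comp hinv
  rw [mulSeries_one] at hmul
  exact hmul.congr hψ_eq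

end Series

section SeriesArray

variable {N : ℕ} [NeZero N]

theorem eq_seriesArray {M : Matrix ℕ ℕ ℂ}
    (hzero : ∀ (l : Fin N) (t : Word N), M 0 (wordIndex (FreeMonoid.of l * t)) = 0)
    (hcons : ∀ (l l' : Fin N) (s t : Word N),
      M (wordIndex (FreeMonoid.of l' * s)) (wordIndex (FreeMonoid.of l * t)) =
        if l = l' then M (wordIndex s) (wordIndex t) else 0) :
    M = seriesArray fun w : Word N ↦ M (wordIndex w) 0 := by
  have hword (t s : Word N) : M (wordIndex s) (wordIndex t) = if t.toList <+: s.toList then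
      M (wordIndex (FreeMonoid.ofList (s.toList.drop t.length))) 0 else 0 := by
    induction t using FreeMonoid.inductionOn' generalizing s with
    | one => exact (if_pos List.nil_prefix).symm
    | of_mul l t ih =>
      induction s using FreeMonoid.inductionOn' with
      | one => exact (hzero l t).trans (if_neg (by simp)).symm
      | of_mul l' s _ =>
        rw [hcons, ih, ← ite_and, FreeMonoid.length_mul, FreeMonoid.length_of, add_comm 1]
        simp only [FreeMonoid.toList_of_mul, List.cons_prefix_cons, List.drop_succ_cons]
  ext m n
  rw [seriesArray, ← hword, wordIndex_wordAt, wordIndex_wordAt]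

theorem mulSeries_toSeries_mono (θ : Series N) (u w : Word N) :
    mulSeries (toSeries (mono u)) θ w = seriesArray θ (wordIndex w) (wordIndex u) := by
  let M : Matrix ℕ ℕ ℂ := fun m n ↦ mulSeries (toSeries (mono (wordAt N n))) θ (wordAt N m)
  have hM (s t : Word N) : M (wordIndex s) (wordIndex t) = mulSeries (toSeries (mono t)) θ s := by
    simp only [M, wordAt_wordIndex]
  have hcoeff_one (l : Fin N) (t : Word N) : toSeries (mono (FreeMonoid.of l * t)) 1 = 0 := by
    rw [mono_of_mul]
    exact coeff_var_mul_one l _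
  have hcol : (fun s : Word N ↦ M (wordIndex s) 0) = θ := by
    ext s
    rw [← wordIndex_one (N := N), hM, mono_one, toSeries_one, one_mulSeries]
  have hM_eq : M = seriesArray fun s : Word N ↦ M (wordIndex s) 0 := by
    refine eq_seriesArray (fun l t ↦ ?_) fun l l' s t ↦ ?_
    · rw [← wordIndex_one (N := N), hM, mulSeries_one_apply, hcoeff_one, zero_mul]
    · have hshift : (fun u ↦ toSeries (mono (FreeMonoid.of l * t)) (FreeMonoid.of l' * u)) =
          if l = l' then toSeries (mono t) else 0 := by
        ext u
        rw [mono_of_mul, toSeries, coeff_var_mul]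
        split_ifs <;> rfl
      rw [hM, hM, mulSeries_of_mul_apply, hcoeff_one, zero_mul, zero_add, hshift]
      split_ifs
      · rfl
      · rw [zero_mulSeries, Pi.zero_apply]
  rw [← hM, hM_eq, hcol]

theorem constr_seriesArray (θ : Series N) (w : Word N) (P : PolyN N) :
    (monoBasis N).constr ℂ (seriesArray θ (wordIndex w)) P = mulSeries (toSeries P) θ w := by
  let mulθ : PolyN N →ₗ[ℂ] ℂ :=
    { toFun P := mulSeries (toSeries P) θ w
      map_add' P Q := by rw [toSeries_add, add_mulSeries, Pi.add_apply]
      map_smul' c P := by rw [toSeries_smul, smul_mulSeries, Pi.smul_apply, RingHom.id_apply] }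
  suffices h : (monoBasis N).constr ℂ (seriesArray θ (wordIndex w)) = mulθ from
    DFunLike.congr_fun h P
  refine (monoBasis N).ext fun n ↦ ?_
  obtain ⟨u, rfl⟩ := wordIndex_surjective (N := N) n
  rw [Module.Basis.constr_basis, monoBasis_wordIndex]
  exact (mulSeries_toSeries_mono θ u w).symm

end SeriesArray

/-! ### Orthogonal polynomials as unit components -/

theorem gramSchmidt_eq_sub_sum {E : Type*} [NormedAddCommGroup E] [InnerProductSpace ℂ E]
    (v : ℕ → E) (n : ℕ) :
    InnerProductSpace.gramSchmidt ℂ v n = v n -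
      ∑ i : Fin n, inner ℂ (InnerProductSpace.gramSchmidtNormed ℂ v i) (v n) •
        InnerProductSpace.gramSchmidtNormed ℂ v i := by
  rw [InnerProductSpace.gramSchmidt_def, Nat.Iio_eq_range, Finset.sum_range]
  congr! 2 with i
  rw [Submodule.starProjection_singleton, InnerProductSpace.gramSchmidtNormed, inner_smul_left,
    smul_smul]
  congr 1
  simp
  ring

namespace FormSpace

variable {N : ℕ} [NeZero N] {φ : QuotAlg (stationaryRel N) →ₗ[ℂ] ℂ} (hpos : StrictlyPositive φ)

theorem ofPoly_orthoPoly (n : ℕ) : ofPoly hpos (orthoPoly φ n) =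
    InnerProductSpace.gramSchmidtNormed ℂ (basis hpos) n := by
  induction n using Nat.strong_induction_on with
  | _ n ih =>
    have hbasis : basis hpos n = ofPoly hpos (mono (wordAt N n)) := by
      rw [← basis_wordIndex, wordIndex_wordAt]
    have hsum : ofPoly hpos (mono (wordAt N n) -
        ∑ i : Fin n, form φ (mono (wordAt N n)) (orthoPoly φ i) • orthoPoly φ i) =
        InnerProductSpace.gramSchmidt ℂ (basis hpos) n := by
      rw [gramSchmidt_eq_sub_sum, map_sub, map_sum, hbasis]
      congr! 2 with i
      rw [← ih i i.2, inner_ofPoly, map_smul]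
    rw [orthoPoly, ← norm_sq_ofPoly hpos, Real.sqrt_sq (norm_nonneg _), map_smul, hsum,
      InnerProductSpace.gramSchmidtNormed]
    simp

theorem orthonormal_orthoPoly : Orthonormal ℂ fun n ↦ ofPoly hpos (orthoPoly φ n) := by
  simp only [ofPoly_orthoPoly]
  exact InnerProductSpace.gramSchmidtNormed_orthonormal (basis hpos).linearIndependent

theorem isUnitComponent_orthoPoly (n : ℕ) :
    IsUnitComponent (basis hpos) (Set.Iio n) n (ofPoly hpos (orthoPoly φ n)) := by
  rw [ofPoly_orthoPoly]
  exact isUnitComponent_gramSchmidtNormed ..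

variable {hpos}

theorem isUnitComponent_var_mul {k : Fin N} {P : PolyN N} {p : Word N} {S T : Set ℕ}
    (hP : IsUnitComponent (basis hpos) S (wordIndex p) (ofPoly hpos P)) (hT_zero : 0 ∉ T)
    (hT : ∀ w, wordIndex (FreeMonoid.of k * w) ∈ T ↔ wordIndex w ∈ S) :
    IsUnitComponent (basis hpos) T (wordIndex (FreeMonoid.of k * p))
      (ofPoly hpos (var k * P)) where
  norm_eq := (norm_ofPoly_var_mul hpos k P).trans hP.norm_eq
  repr_eq_zero i hi hip := by
    obtain ⟨w, rfl⟩ := wordIndex_surjective (N := N) i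
    rw [basis_repr_wordIndex]
    induction w using FreeMonoid.inductionOn' with
    | one => exact coeff_var_mul_one k P
    | of_mul l w _ =>
      rw [coeff_var_mul, ite_eq_right_iff]
      rintro rfl
      rw [← basis_repr_wordIndex hpos]
      refine hP.repr_eq_zero _ (mt (hT w).2 hi) fun h ↦ hip ?_
      rw [wordIndex_injective h]
  repr_pos := by
    rw [basis_repr_wordIndex, coeff_var_mul, if_pos rfl, ← basis_repr_wordIndex hpos]
    exact hP.repr_pos
  inner_eq_zero i hi := by
    obtain ⟨w, rfl⟩ := wordIndex_surjective (N := N) i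
    induction w using FreeMonoid.inductionOn' with
    | one => exact absurd hi hT_zero
    | of_mul l w _ =>
      rw [basis_wordIndex, mono_of_mul, inner_ofPoly, form_var_mul, ite_eq_right_iff]
      rintro rfl
      rw [← inner_ofPoly hpos, ← basis_wordIndex]
      exact hP.inner_eq_zero _ ((hT w).1 hi)

variable (hpos)

theorem ofPoly_shiftedPoly (n : ℕ) :
    ofPoly hpos (shiftedPoly φ (wordAt N (n + 1)).toList) =
      forwardVec (basis hpos) 1 (n + 1) := by
  have hn := wordIndex_wordAt (N := N) (n + 1)
  generalize wordAt N (n + 1) = w at hn ⊢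
  induction w using FreeMonoid.inductionOn' with
  | one => cases hn
  | of_mul k s _ =>
    rw [FreeMonoid.toList_of_mul, shiftedPoly, FreeMonoid.ofList_toList, ← hn]
    refine (isUnitComponent_var_mul (isUnitComponent_orthoPoly hpos (wordIndex s)) ?_
      fun w ↦ ?_).unique (isUnitComponent_forwardVec ..)
    · simp
    · simp [wordIndex_of_mul_lt_iff, Nat.one_le_iff_ne_zero, (wordIndex_of_mul_pos k w).ne']

theorem ofPoly_sharpPoly (hunit : φ 1 = 1) (n : ℕ) :
    ofPoly hpos (sharpPoly φ n) = backwardVec (basis hpos) 0 n := by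
  induction n with
  | zero =>
    have hbasis : basis hpos 0 = ofPoly hpos 1 := by
      rw [← wordIndex_one (N := N), basis_wordIndex, mono_one]
    simp [sharpPoly, backwardVec, unitComponent, hbasis, norm_ofPoly_one hpos hunit]
  | succ n ih =>
    rw [backwardVec_succ _ n.zero_le, sharpPoly, kernel_eq_gram hpos, param_gram, map_smul, map_add,
      map_neg, map_smul, ih, ofPoly_shiftedPoly, neg_add_eq_sub]

theorem isUnitComponent_sharpPoly (hunit : φ 1 = 1) (k : ℕ) :
    IsUnitComponent (basis hpos) (Finset.Ioc 0 k) 0 (ofPoly hpos (sharpPoly φ k)) := by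
  rw [ofPoly_sharpPoly hpos hunit]
  exact isUnitComponent_backwardVec ..

theorem isUnitComponent_mono_mul_sharpPoly (hunit : φ 1 = 1) (s : Word N) (k : ℕ) :
    IsUnitComponent (basis hpos)
      {i | wordIndex s < i ∧ ∀ w, wordIndex (s * w) = i → wordIndex w ≤ k} (wordIndex s)
      (ofPoly hpos (mono s * sharpPoly φ k)) := by
  induction s using FreeMonoid.inductionOn' with
  | one =>
    rw [mono_one, one_mul, wordIndex_one]
    convert isUnitComponent_sharpPoly hpos hunit k using 1
    ext i
    obtain ⟨w, rfl⟩ := wordIndex_surjective (N := N) i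
    simp [wordIndex_injective.eq_iff]
  | of_mul l s ih =>
    rw [mono_of_mul, mul_assoc]
    refine isUnitComponent_var_mul ih (by simp) fun w ↦ ?_
    simp [wordIndex_of_mul_lt_iff, wordIndex_injective.eq_iff, mul_assoc]

end FormSpace

/-! ### The Szegő class -/

section Szego

open FormSpace

variable {N : ℕ} [NeZero N] {φ : QuotAlg (stationaryRel N) →ₗ[ℂ] ℂ} {Θ : Matrix ℕ ℕ ℂ}

theorem IsSpectralFactor.diag_pos (hpos : StrictlyPositive φ) (hS : SzegoClass (kernel φ))
    (hΘ : IsSpectralFactor (kernel φ) Θ) (m : ℕ) : 0 < Θ m m := by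
  obtain ⟨Θ₀, hΘ₀, hpos₀⟩ := hS
  rw [kernel_eq_gram hpos] at hΘ hΘ₀
  rw [hΘ.diag_eq_infDist, ← hΘ₀.diag_eq_infDist]
  exact hpos₀ m

theorem IsSpectralFactor.tendsto_form_and_constr (hpos : StrictlyPositive φ) (hunit : φ 1 = 1)
    (hS : SzegoClass (kernel φ)) (hΘ : IsSpectralFactor (kernel φ) Θ) (s : Word N) :
    (∀ t, Tendsto (fun k ↦ form φ (mono t) (mono s * sharpPoly φ k)) atTop
      (𝓝 (Θ (wordIndex s) (wordIndex t)))) ∧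
    ∀ w : Word N, Tendsto
      (fun k ↦ (monoBasis N).constr ℂ (Θ (wordIndex w)) (mono s * sharpPoly φ k)) atTop
      (𝓝 (if wordIndex w = wordIndex s then 1 else 0)) := by
  have hdiag := hΘ.diag_pos hpos hS (wordIndex s)
  rw [kernel_eq_gram hpos] at hΘ
  have hexhaust (i : ℕ) (hi : wordIndex s < i) : ∀ᶠ k in atTop,
      i ∈ {i | wordIndex s < i ∧ ∀ w, wordIndex (s * w) = i → wordIndex w ≤ k} := by
    by_cases! h : ∃ u, wordIndex (s * u) = i
    · obtain ⟨u, rfl⟩ := h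
      filter_upwards [eventually_ge_atTop (wordIndex u)] with k hk
      refine ⟨hi, fun w hw ↦ ?_⟩
      rwa [mul_left_cancel (wordIndex_injective hw)]
    · exact .of_forall fun k ↦ ⟨hi, fun w hw ↦ absurd hw (h w)⟩
  obtain ⟨hinner, hconstr⟩ := hΘ.tendsto_inner_and_constr hdiag
    (isUnitComponent_mono_mul_sharpPoly hpos hunit s) (fun _ _ hi ↦ hi.1) hexhaust
  refine ⟨fun t ↦ ?_, fun w ↦ hconstr (wordIndex w)⟩
  have ht := hinner (wordIndex t)
  rwa [basis_wordIndex] at ht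

theorem IsSpectralFactor.eq_seriesArray (hpos : StrictlyPositive φ) (hunit : φ 1 = 1)
    (hS : SzegoClass (kernel φ)) (hΘ : IsSpectralFactor (kernel φ) Θ) :
    Θ = seriesArray fun w : Word N ↦ Θ (wordIndex w) 0 := by
  have htendsto (s) := (hΘ.tendsto_form_and_constr hpos hunit hS s).1
  refine TreeSzego.eq_seriesArray (fun l t ↦ hΘ.lower (wordIndex_of_mul_pos l t))
    fun l l' s t ↦ ?_
  have hlim := htendsto (FreeMonoid.of l' * s) (FreeMonoid.of l * t)
  simp only [mono_of_mul, mul_assoc, form_var_mul] at hlim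
  split_ifs at hlim ⊢
  · exact tendsto_nhds_unique hlim (htendsto s t)
  · exact tendsto_nhds_unique hlim tendsto_const_nhds

theorem tendsto_mulSeries_sharpPoly (hpos : StrictlyPositive φ) (hunit : φ 1 = 1)
    (hS : SzegoClass (kernel φ)) {θ : Series N}
    (hΘ : IsSpectralFactor (kernel φ) (seriesArray θ)) :
    Tendsto (fun n ↦ mulSeries (toSeries (sharpPoly φ n)) θ) atTop (𝓝 (oneSeries N)) := by
  refine tendsto_pi_nhds.2 fun w ↦ ?_
  have hlim := (hΘ.tendsto_form_and_constr hpos hunit hS 1).2 w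
  simp only [mono_one, one_mul, constr_seriesArray] at hlim
  convert hlim using 2
  exact if_congr (by rw [wordIndex_injective.eq_iff, FreeMonoid.length_eq_zero]) rfl rfl

theorem toSeries_sharpPoly_one_ne_zero (hpos : StrictlyPositive φ) (hunit : φ 1 = 1) (n : ℕ) :
    toSeries (sharpPoly φ n) 1 ≠ 0 := by
  have hrepr := (isUnitComponent_sharpPoly hpos hunit n).repr_pos
  rw [← wordIndex_one (N := N), basis_repr_wordIndex] at hrepr
  exact hrepr.ne'

theorem tendsto_toSeries_orthoPoly (hpos : StrictlyPositive φ) (hS : SzegoClass (kernel φ))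
    (w : Word N) : Tendsto (fun n ↦ toSeries (orthoPoly φ n) w) atTop (𝓝 0) := by
  obtain ⟨Θ, hΘ, hdiag⟩ := hS
  rw [kernel_eq_gram hpos] at hΘ
  have hlim := hΘ.tendsto_repr_of_orthonormal hdiag (orthonormal_orthoPoly hpos) (wordIndex w)
  simp only [basis_repr_wordIndex, Nat.cofinite_eq_atTop] at hlim
  exact hlim

theorem isSpectralFactor_spectralFactor {K : Matrix ℕ ℕ ℂ} (hS : SzegoClass K) :
    IsSpectralFactor K (spectralFactor K) :=
  Classical.epsilon_spec (hS.imp fun _ hΘ ↦ hΘ.1)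

end Szego

end TreeSzego

theorem theorem4p1 (N : ℕ) [NeZero N] (φ : QuotAlg (stationaryRel N) →ₗ[ℂ] ℂ)
    (hpos : StrictlyPositive φ) (hunit : φ 1 = 1) (hS : SzegoClass (kernel φ)) :
    (∀ w : Word N, Tendsto (fun n => toSeries (orthoPoly φ n) w) atTop (𝓝 0)) ∧
    ∃ θ : Series N, spectralFactor (kernel φ) = seriesArray θ ∧
      ∃ ψ : ℕ → Series N, (∀ n, IsInverse (toSeries (sharpPoly φ n)) (ψ n)) ∧
        ∀ w : Word N, Tendsto (fun n => ψ n w) atTop (𝓝 (θ w)) := by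
  have hΘ := isSpectralFactor_spectralFactor hS
  obtain ⟨θ, hθ⟩ : ∃ θ : Series N, spectralFactor (kernel φ) = seriesArray θ :=
    ⟨_, hΘ.eq_seriesArray hpos hunit hS⟩
  have hθ_one : θ 1 ≠ 0 := by
    have hdiag := hΘ.diag_pos hpos hS 0
    rw [hθ, seriesArray, if_pos (List.prefix_refl _)] at hdiag
    simpa [wordAt] using hdiag.ne'
  rw [hθ] at hΘ
  have hsharp := toSeries_sharpPoly_one_ne_zero hpos hunit
  have hinv (n : ℕ) := isInverse_seriesInv (hsharp n)
  exact ⟨tendsto_toSeries_orthoPoly hpos hS, θ, hθ, _, hinv, tendsto_pi_nhds.1 <|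
    tendsto_of_isInverse_of_tendsto_mulSeries hθ_one hsharp hinv
      (tendsto_mulSeries_sharpPoly hpos hunit hS hΘ)⟩
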